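/- A structure $(M,S_1,S_2,\dots,\#)$ consists of a set $M$, non-empty collections $S_n\subseteq P(M^n)$ for $n\ge 1$, and a function $\#:S_1\to M$. Formulas are those of the corresponding many-sorted language: object variables range over $M$, $n$-ary relation variables over $S_n$ (set variables over $S_1$), and object terms are object variables and $\#X$ with $X$ a set variable. A formula is arithmetical if it has no bound relation variables; it is $\Sigma^1_1$ (resp. $\Pi^1_1$) if it consists of finitely many existential (resp. universal) relation quantifiers, of any arities, in front of an arithmetical formula. The theory $\Delta^1_1\text{-}\mathrm{HP}_0$ consists of Hume's Principle, "$\#X=\#Y$ if and only if there is (in $S_2$) the graph of a bijection $f:X\to Y$", together with all instances, with object and relation parameters, of $$[\forall \bar n\,(\varphi(\bar n)\leftrightarrow\psi(\bar n))]\rightarrow \exists R\,\forall\bar n\,(\bar n\in R\leftrightarrow\varphi(\bar n)),$$ where $\varphi$ is $\Sigma^1_1$, $\psi$ is $\Pi^1_1$, and $R$ is not free in $\varphi,\psi$. Write $P(n,m)$ if there are $X,Y\in S_1$ with $\#X=n$, $\#Y=m$ and $X=Y\setminus\{y\}$ for some $y\in Y$. A set $F\in S_1$ is hereditary if $n\in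 F$ and $P(n,m)$ imply $m\in F$, and closed if $P(\#\emptyset,m)$ implies $m\in F$. An object $n$ is a pseudo-number if $n=\#\emptyset$ or $n$ belongs to every hereditary, closed $F\in S_1$. The successor axiom $\mathrm{SA}$ says that for every pseudo-number $n$ there is $m$ with $P(n,m)$. Let $k$ be an algebraically closed field of characteristic zero that is saturated as a structure in the language of rings: for every $A\subseteq k$ with $|A|<|k|$, every finitely realized set of formulas over $A$ in finitely many free variables is realized in $k$. Let $D(k^n)$ be the collection of subsets of $k^n$ definable with parameters in $k$. Then every $X\in D(k)$ is finite or cofinite. Define $\#:D(k)\to k$ by $\#X=|X|$ if $X$ is finite and $\#X=-(|k\setminus X|+1)$ if $X$ is cofinite. Then this is well defined, and $$(k,D(k),D(k^2),\dots,\#)\models \Delta^1_1\text{-}\mathrm{HP}_0+\neg\mathrm{SA}.$$ Moreover, the pseudo-numbers of this structure are exactly the integers, and $\#k=-1$ has no successor: there is no $m\in k$ with $P(\#k,m)$. In particular, there is a model of $\Delta^1_1\text{-}\mathrm{HP}_0+\neg\mathrm{SA}$, which answers a question of Linnebo. -/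

import Mathlib

universe u v w

/-- A first-order structure `M` is saturated if, for every `A ⊆ M` with `|A| < |M|`, every set of
formulas with parameters from `A` in finitely many free variables that is finitely realized
in `M` is realized in `M`. -/
def FirstOrder.Language.IsSaturated (L : FirstOrder.Language.{v, w}) (M : Type u)
    [L.Structure M] : Prop :=
  ∀ A : Set M, Cardinal.mk A < Cardinal.mk M →
    ∀ (n : ℕ) (p : Set ((L.withConstants A).Formula (Fin n))),
      (∀ q : Set ((L.withConstants A).Formula (Fin n)), q ⊆ p → q.Finite →
        ∃ b : Fin n → M, ∀ θ ∈ q, θ.Realize b) →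
      ∃ b : Fin n → M, ∀ θ ∈ p, θ.Realize b

/-- A structure `(M, S₁, S₂, …, #)` in the signature of Hume's Principle: `rel n` is the collection
`S_{n+1}` of `(n+1)`-ary relations on `M` over which the relation quantifiers range, and
`num : S₁ → M` is the interpretation of `#`. As usual in many-sorted logic, the sorts are non-empty
(for `M` this follows from the existence of `num`). -/
structure HPStructure (M : Type u) where
  rel : (n : ℕ) → Set (Set (Fin (n + 1) → M))
  rel_nonempty : ∀ n, (rel n).Nonempty
  num : rel 0 → M

/-- Object terms of the signature: object variables `x_i` and `# X_i`, for `X_i` a set variable. -/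
inductive HPTerm : Type
  | var (i : ℕ) : HPTerm
  | num (i : ℕ) : HPTerm

/-- Formulas of the many-sorted signature of Hume's Principle. The `(n+1)`-ary relation variables
are indexed by pairs `(n, i)`; set variables are the pairs `(0, i)`. The remaining connectives and
the existential object quantifier are the usual classical abbreviations. -/
inductive HPFormula : Type
  /-- equality of objects -/
  | eq (t s : HPTerm) : HPFormula
  /-- equality of two `(n+1)`-ary relations -/
  | relEq (n i j : ℕ) : HPFormula
  /-- the relation variable `(n, i)` holds of the `(n+1)`-tuple `t` -/
  | mem (n i : ℕ) (t : Fin (n + 1) → HPTerm) : HPFormula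
  | neg (φ : HPFormula) : HPFormula
  | and (φ ψ : HPFormula) : HPFormula
  | allObj (i : ℕ) (φ : HPFormula) : HPFormula
  | allRel (n i : ℕ) (φ : HPFormula) : HPFormula
  | exRel (n i : ℕ) (φ : HPFormula) : HPFormula

namespace HPFormula

/-- A formula is arithmetical if it contains no bound relation variables of any arity. -/
def IsArithmetical : HPFormula → Prop
  | eq _ _ => True
  | relEq _ _ _ => True
  | mem _ _ _ => True
  | neg φ => φ.IsArithmetical
  | and φ ψ => φ.IsArithmetical ∧ ψ.IsArithmetical
  | allObj _ φ => φ.IsArithmetical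
  | allRel _ _ _ => False
  | exRel _ _ _ => False

/-- `Σ¹₁`: finitely many existential relation quantifiers in front of an arithmetical formula. -/
inductive IsSigma11 : HPFormula → Prop
  | arith {φ : HPFormula} (h : φ.IsArithmetical) : IsSigma11 φ
  | ex (n i : ℕ) {φ : HPFormula} (h : IsSigma11 φ) : IsSigma11 (exRel n i φ)

/-- `Π¹₁`: finitely many universal relation quantifiers in front of an arithmetical formula. -/
inductive IsPi11 : HPFormula → Prop
  | arith {φ : HPFormula} (h : φ.IsArithmetical) : IsPi11 φ
  | all (n i : ℕ) {φ : HPFormula} (h : IsPi11 φ) : IsPi11 (allRel n i φ)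

end HPFormula

namespace HPStructure

variable {M : Type u}

/-- An assignment of relations of the structure to all relation variables. -/
abbrev RelAssignment (N : HPStructure M) : Type u := (n : ℕ) → ℕ → N.rel n

/-- Reassign the `(n+1)`-ary relation variable `(n, i)` to `R`. -/
def RelAssignment.set {N : HPStructure M} (ρ : N.RelAssignment) (n i : ℕ) (R : N.rel n) :
    N.RelAssignment :=
  Function.update ρ n (Function.update (ρ n) i R)

/-- The value of an object term. -/
def termValue (N : HPStructure M) (v : ℕ → M) (ρ : N.RelAssignment) : HPTerm → M
  | .var i => v i
  | .num i => N.num (ρ 0 i)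

/-- Satisfaction of a formula in the structure under an assignment: object quantifiers range over
`M`, and quantifiers over `(n+1)`-ary relations range over `N.rel n`. -/
def Sat (N : HPStructure M) : HPFormula → (ℕ → M) → N.RelAssignment → Prop
  | .eq t s, v, ρ => N.termValue v ρ t = N.termValue v ρ s
  | .relEq n i j, _, ρ => ρ n i = ρ n j
  | .mem n i t, v, ρ => (fun j => N.termValue v ρ (t j)) ∈ (ρ n i : Set (Fin (n + 1) → M))
  | .neg φ, v, ρ => ¬ N.Sat φ v ρ
  | .and φ ψ, v, ρ => N.Sat φ v ρ ∧ N.Sat ψ v ρ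
  | .allObj i φ, v, ρ => ∀ a : M, N.Sat φ (Function.update v i a) ρ
  | .allRel n i φ, v, ρ => ∀ R : N.rel n, N.Sat φ v (ρ.set n i R)
  | .exRel n i φ, v, ρ => ∃ R : N.rel n, N.Sat φ v (ρ.set n i R)

/-- The `Δ¹₁`-comprehension schema: for `φ` a `Σ¹₁`-formula, `ψ` a `Π¹₁`-formula, and a tuple `z` of
distinct object variables, if `φ` and `ψ` agree at all values of `z` (the other free
variables being object or relation parameters, given by `v` and `ρ`), then the relation defined
by `φ` in the variables `z` belongs to the structure. -/
def Delta11Comprehension (N : HPStructure M) : Prop :=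
  ∀ φ ψ : HPFormula, φ.IsSigma11 → ψ.IsPi11 →
    ∀ (n : ℕ) (z : Fin (n + 1) → ℕ), Function.Injective z →
    ∀ (v : ℕ → M) (ρ : N.RelAssignment),
      (∀ a : Fin (n + 1) → M,
        N.Sat φ (Function.extend z a v) ρ ↔ N.Sat ψ (Function.extend z a v) ρ) →
      ∃ R : N.rel n, ∀ a : Fin (n + 1) → M,
        a ∈ (R : Set (Fin (n + 1) → M)) ↔ N.Sat φ (Function.extend z a v) ρ

/-- Membership of an object in a set of the structure. -/
def Mem (N : HPStructure M) (x : M) (X : N.rel 0) : Prop := ![x] ∈ (X : Set (Fin 1 → M))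

/-- The binary relation `f` of the structure is (the graph of) a bijection from `X` to `Y`. -/
def IsBijection (N : HPStructure M) (f : N.rel 1) (X Y : N.rel 0) : Prop :=
  (∀ x y, ![x, y] ∈ (f : Set (Fin 2 → M)) → N.Mem x X ∧ N.Mem y Y) ∧
  (∀ x, N.Mem x X → ∃! y, ![x, y] ∈ (f : Set (Fin 2 → M))) ∧
  (∀ y, N.Mem y Y → ∃! x, ![x, y] ∈ (f : Set (Fin 2 → M)))

/-- Hume's Principle: `#X = #Y` iff there is a bijection `f : X → Y` in the structure. -/
def HumesPrinciple (N : HPStructure M) : Prop :=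
  ∀ X Y : N.rel 0, N.num X = N.num Y ↔ ∃ f : N.rel 1, N.IsBijection f X Y

/-- The structure is a model of `Δ¹₁-HP₀`. -/
def ModelsDelta11HP (N : HPStructure M) : Prop :=
  N.HumesPrinciple ∧ N.Delta11Comprehension

/-- `P(n, m)`: there are sets `X`, `Y` with `#X = n`, `#Y = m` and `X = Y \ {y}`
for some `y ∈ Y`. -/
def Precedes (N : HPStructure M) (n m : M) : Prop :=
  ∃ X Y : N.rel 0, N.num X = n ∧ N.num Y = m ∧
    ∃ y, N.Mem y Y ∧ ∀ x, N.Mem x X ↔ N.Mem x Y ∧ x ≠ y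

/-- `n = #∅`. -/
def IsZero (N : HPStructure M) (n : M) : Prop :=
  ∃ E : N.rel 0, (∀ x, ¬ N.Mem x E) ∧ n = N.num E

/-- `F` is hereditary if `Fn` and `P(n, m)` imply `Fm`. -/
def Hereditary (N : HPStructure M) (F : N.rel 0) : Prop :=
  ∀ n m, N.Mem n F → N.Precedes n m → N.Mem m F

/-- `F` is closed if `P(#∅, m)` implies `Fm`. -/
def IsClosedSet (N : HPStructure M) (F : N.rel 0) : Prop :=
  ∀ z m, N.IsZero z → N.Precedes z m → N.Mem m F

/-- `n` is a pseudo-number if `n = #∅` or `n` lies in every hereditary, closed set `F`. -/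
def IsPseudoNumber (N : HPStructure M) (n : M) : Prop :=
  N.IsZero n ∨ ∀ F : N.rel 0, N.Hereditary F → N.IsClosedSet F → N.Mem n F

/-- The successor axiom `SA`: for every pseudo-number `n` there is `m` with `P(n, m)`. -/
def SuccessorAxiom (N : HPStructure M) : Prop :=
  ∀ n, N.IsPseudoNumber n → ∃ m, N.Precedes n m

open Classical in
/-- The structure `(k, D(k), D(k²), …, #)`, where `D(kⁿ)` is the collection of subsets of `kⁿ`
definable with parameters in the field `k`, `#X = |X|` for `X` finite and `#X = -(|k \ X| + 1)`
for `X` cofinite. -/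
noncomputable def ofField (k : Type u) [Field k] [FirstOrder.Ring.CompatibleRing k] :
    HPStructure k where
  rel n := {X : Set (Fin (n + 1) → k) | (Set.univ : Set k).Definable FirstOrder.Language.ring X}
  rel_nonempty _ := ⟨∅, Set.definable_empty⟩
  num X :=
    if (X : Set (Fin 1 → k)).Finite then ((X : Set (Fin 1 → k)).ncard : k)
    else -(((X : Set (Fin 1 → k))ᶜ.ncard : k) + 1)

end HPStructure

/-!
Let `k` be algebraically closed of characteristic zero, and let `|X|` for finite `X` and
`-(|k \ X| + 1)` for cofinite `X` be the signed cardinality of `X`. All objects `#X` are integers,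
and `P(n, m)` holds iff `n ≠ -1` and `m = n + 1`: adding a point raises the signed cardinality by
one, whether `X` is finite or cofinite, and only `X = k` has no room for it. So starting from `0`
every hereditary set contains all natural numbers; being definable and infinite it is cofinite,
hence contains very negative integers, and then all negative ones, up to `-1`, where it stops.

* A definable `X ⊆ k` is finite or cofinite. In an `ℵ₀`-saturated field an infinite definable set
  contains a point transcendental over its parameters, and all such points are conjugate under
  automorphisms; the general case follows by passing to an ultrapower.
* Hume's Principle amounts to: a definable bijection between cofinite sets `X`, `Y` forces
  `|k \ X| = |k \ Y|`. Otherwise, extending it by finitely many values would give a definable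
  injection of `k` into itself which is not surjective, against the Ax–Grothendieck theorem.
* Arithmetical formulas define definable sets: `#` takes integer values and its level sets on a
  definable family are definable, so by saturation it takes finitely many values on the family.
  A `Σ¹₁` formula therefore defines a union of sets definable over a fixed finite set of
  parameters, the witnessing relations being fibres of families definable without parameters. If
  its complement is of the same kind, saturation makes both definable.
-/

open FirstOrder FirstOrder.Language

section Saturation

variable {L : FirstOrder.Language.{v, w}} {M : Type u} [L.Structure M]

/-- A structure is `ℵ₀`-saturated if every set of formulas in finitely many free variables over a
finite set of parameters which is finitely realized is realized. -/
def Aleph0Saturated (L : FirstOrder.Language.{v, w}) (M : Type u) [L.Structure M] : Prop :=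
  ∀ A : Set M, A.Finite → ∀ (n : ℕ) (p : Set (L[[A]].Formula (Fin n))),
    (∀ q ⊆ p, q.Finite → ∃ b : Fin n → M, ∀ θ ∈ q, θ.Realize b) →
      ∃ b : Fin n → M, ∀ θ ∈ p, θ.Realize b

theorem aleph0Saturated_of_isSaturated [Infinite M] (h : L.IsSaturated M) :
    Aleph0Saturated L M :=
  fun A hA => h A (hA.lt_aleph0.trans_le (Cardinal.aleph0_le_mk M))

theorem Aleph0Saturated.exists_finite_subcover (h : Aleph0Saturated L M) {A : Set M}
    (hA : A.Finite) {β : Type*} [Finite β] {C : Set (Set (β → M))}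
    (hC : ∀ s ∈ C, A.Definable L s) (hcov : ⋃₀ C = Set.univ) :
    ∃ D ⊆ C, D.Finite ∧ ⋃₀ D = Set.univ := by
  obtain ⟨n, ⟨e⟩⟩ := Finite.exists_equiv_fin β
  let avoided (θ : L[[A]].Formula (Fin n)) : Set (β → M) := {x | ¬ θ.Realize (x ∘ e.symm)}
  by_contra! hno
  obtain ⟨b, hb⟩ := h A hA n (avoided ⁻¹' C) fun q hq hqf => by
    obtain ⟨x, hx⟩ := (Set.ne_univ_iff_exists_notMem _).1
      (hno (avoided '' q) (Set.image_subset_iff.2 hq) (hqf.image _))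
    refine ⟨x ∘ e.symm, fun θ hθ => ?_⟩
    by_contra hneg
    exact hx ⟨_, ⟨θ, hθ, rfl⟩, hneg⟩
  obtain ⟨s, hs, hbs⟩ : b ∘ e ∈ ⋃₀ C := hcov ▸ Set.mem_univ _
  obtain ⟨θ, hθ⟩ := (hC s hs).compl.preimage_comp e
  have hθ_iff (x : β → M) : x ∉ s ↔ θ.Realize (x ∘ e.symm) := by
    simpa [Function.comp_assoc] using Set.ext_iff.1 hθ (x ∘ e.symm)
  have havoided : avoided θ = s := by
    ext x
    exact (not_congr (hθ_iff x)).symm.trans not_not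
  have hrealize : θ.Realize ((b ∘ e) ∘ e.symm) := by
    simpa [Function.comp_assoc] using hb θ (show avoided θ ∈ C from havoided.symm ▸ hs)
  exact (hθ_iff _).2 hrealize hbs

theorem definable_sUnion_of_finite {A : Set M} {β : Type*} {C : Set (Set (β → M))}
    (hf : C.Finite) (h : ∀ s ∈ C, A.Definable L s) : A.Definable L (⋃₀ C) := by
  have := hf.to_subtype
  rw [Set.sUnion_eq_iUnion]
  exact Set.definable_iUnion_of_finite fun s => h s s.2

/-- `O` is a union of sets definable over `A`; such sets are also called `⋁`-definable. -/
def IsLocallyDefinable (A : Set M) (L : FirstOrder.Language.{v, w}) [L.Structure M]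
    {β : Type*} (O : Set (β → M)) : Prop :=
  ∀ x ∈ O, ∃ s ⊆ O, A.Definable L s ∧ x ∈ s

theorem isLocallyDefinable_of_definable {A : Set M} {β : Type*} {s : Set (β → M)}
    (h : A.Definable L s) : IsLocallyDefinable A L s :=
  fun _ hx => ⟨s, subset_rfl, h, hx⟩

theorem IsLocallyDefinable.definable {A : Set M} {β : Type*} [Finite β] {O : Set (β → M)}
    (hO : IsLocallyDefinable A L O) (hOc : IsLocallyDefinable A L Oᶜ) (h : Aleph0Saturated L M)
    (hA : A.Finite) : A.Definable L O := by
  obtain ⟨C, hC, hf, hu⟩ := h.exists_finite_subcover hA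
    (C := {s | A.Definable L s ∧ (s ⊆ O ∨ s ⊆ Oᶜ)}) (fun s hs => hs.1) <| by
      refine Set.eq_univ_of_forall fun x => ?_
      by_cases hx : x ∈ O
      · obtain ⟨s, hsO, hs, hxs⟩ := hO x hx
        exact ⟨s, ⟨hs, .inl hsO⟩, hxs⟩
      · obtain ⟨s, hsO, hs, hxs⟩ := hOc x hx
        exact ⟨s, ⟨hs, .inr hsO⟩, hxs⟩
  have hO_eq : O = ⋃₀ {s ∈ C | s ⊆ O} := by
    refine (Set.sUnion_subset fun s hs => hs.2).antisymm' fun x hx => ?_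
    obtain ⟨s, hs, hxs⟩ : x ∈ ⋃₀ C := hu ▸ Set.mem_univ x
    exact ⟨s, ⟨hs, (hC hs).2.resolve_right fun hsO => hsO hxs hx⟩, hxs⟩
  rw [hO_eq]
  exact definable_sUnion_of_finite (hf.subset (Set.sep_subset _ _)) fun s hs => (hC hs.1).1

theorem Aleph0Saturated.definableFun_of_locally_eqOn (h : Aleph0Saturated L M) {A : Set M}
    (hA : A.Finite) {β : Type*} [Finite β] {f : (β → M) → M}
    (hf : ∀ p, ∃ D, p ∈ D ∧ A.Definable L D ∧ ∃ g, A.DefinableFun L g ∧ Set.EqOn f g D) :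
    A.DefinableFun L f := by
  refine IsLocallyDefinable.definable (fun x hx => ?_) (fun x hx => ?_) h hA <;>
    obtain ⟨D, hxD, hD, g, hg, hfg⟩ := hf (x ∘ some)
  · refine ⟨(· ∘ some) ⁻¹' D ∩ g.tupleGraph, ?_, (hD.preimage_comp some).inter hg, hxD, ?_⟩
    · exact fun y hy => (hfg hy.1).trans hy.2
    · exact (hfg hxD).symm.trans hx
  · refine ⟨(· ∘ some) ⁻¹' D ∩ g.tupleGraphᶜ, ?_, (hD.preimage_comp some).inter hg.compl,
      hxD, ?_⟩
    · exact fun y hy hy' => hy.2 ((hfg hy.1).symm.trans hy')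
    · exact fun hx' => hx ((hfg hxD).trans hx')

end Saturation

section Definability

variable {L : FirstOrder.Language.{v, w}} {M : Type u} [L.Structure M] {β : Type*}

theorem definable_comp_mem_iff {A : Set M} {s : Set (β → M)} (hs : A.Definable L s)
    (σ : M ≃[L] M) (hσ : ∀ a ∈ A, σ a = a) (x : β → M) : σ ∘ x ∈ s ↔ x ∈ s := by
  obtain ⟨φ, rfl⟩ := Set.definable_iff_exists_formula_sum.1 hs
  have hcomp : σ ∘ Sum.elim (fun a : A => (a : M)) x = Sum.elim (↑) (σ ∘ x) := by
    rw [Sum.comp_elim]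
    exact congrArg (Sum.elim · _) (funext fun a => hσ a a.2)
  simpa only [hcomp, Set.mem_ofPred_eq] using
    StrongHomClass.realize_formula σ φ (v := Sum.elim (↑) x)

theorem definable_of_finite [Finite β] {s : Set (β → M)} (hs : s.Finite) :
    (Set.univ : Set M).Definable L s := by
  have hsingleton (x : β → M) : (Set.univ : Set M).Definable L {x} := by
    have hx : ({x} : Set (β → M)) = ⋂ i, {y | y i = x i} := by ext; simp [funext_iff]
    rw [hx]
    exact Set.definable_iInter_of_finite fun i => (Set.DefinableFun.proj L).ofPred_eq_const trivial
  rw [← Set.biUnion_of_singleton s, ← Set.sUnion_image]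
  exact definable_sUnion_of_finite (hs.image _) (Set.forall_mem_image.2 fun x _ => hsingleton x)

theorem exists_empty_definable_fiber {A : Set M} {s : Set (β → M)} (hs : A.Definable L s) :
    ∃ (m : ℕ) (b : Fin m → M) (E : Set (Fin m ⊕ β → M)),
      (∅ : Set M).Definable L E ∧ s = {x | Sum.elim b x ∈ E} := by
  obtain ⟨A₀, -, hs⟩ := Set.definable_iff_finitely_definable.1 hs
  obtain ⟨φ, rfl⟩ := Set.definable_iff_exists_formula_sum.1 hs
  obtain ⟨m, ⟨e⟩⟩ := Finite.exists_equiv_fin (A₀ : Set M)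
  refine ⟨m, fun i => e.symm i, {x | φ.Realize (x ∘ Sum.map e id)},
    Set.empty_definable_iff.2 ⟨φ.relabel (Sum.map e id), ?_⟩, ?_⟩
  · ext
    simp [Formula.realize_relabel]
  · ext x
    have hcomp : Sum.elim (fun i => (e.symm i : M)) x ∘ Sum.map e id = Sum.elim (↑) x := by
      ext (i | i) <;> simp
    simp only [Set.mem_ofPred_eq, hcomp]

theorem definable_fiber [Finite β] {γ : Type*} [Finite γ] {A : Set M} {E : Set (γ ⊕ β → M)}
    (hE : A.Definable L E) (c : γ → M) :
    (Set.univ : Set M).Definable L {x : β → M | Sum.elim c x ∈ E} :=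
  (hE.mono A.subset_univ).preimage_map (F := Sum.elim c) <|
    Sum.rec (fun _ => L.definableFun_const _ trivial) fun _ => Set.DefinableFun.proj L

end Definability

section StronglyMinimal

theorem exists_algEquiv_map_eq_of_algebraicIndepOn {k : Type u} [Field k] [IsAlgClosed k]
    {R : Type*} [CommRing R] [Algebra R k] {t s : k} (h : AlgebraicIndepOn R id {t, s}) :
    ∃ σ : k ≃ₐ[R] k, σ t = s := by
  classical
  obtain ⟨B, hB, hb⟩ := exists_isTranscendenceBasis_superset h
  let t' : B := ⟨t, hB (by simp)⟩
  let s' : B := ⟨s, hB (by simp)⟩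
  let swap : Algebra.adjoin R (Set.range ((↑) : B → k)) ≃ₐ[R]
      Algebra.adjoin R (Set.range ((↑) : B → k)) :=
    (hb.1.aevalEquiv.symm.trans (MvPolynomial.renameEquiv R (Equiv.swap t' s'))).trans
      hb.1.aevalEquiv
  have := IsAlgClosed.isAlgClosure_of_transcendence_basis _ hb
  let σ : k ≃+* k := IsAlgClosure.equivOfEquiv k k swap.toRingEquiv
  have hσ (x) : σ (algebraMap _ k x) = algebraMap _ k (swap x) :=
    IsAlgClosure.equivOfEquiv_algebraMap k k swap.toRingEquiv x
  refine ⟨AlgEquiv.ofRingEquiv (f := σ) fun r => ?_, ?_⟩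
  · simpa only [swap.commutes] using! hσ (algebraMap R _ r)
  · have ht : hb.1.aevalEquiv (MvPolynomial.X t') = ⟨t, Algebra.subset_adjoin ⟨t', rfl⟩⟩ := by
      ext
      simp [t']
    simpa [← ht, swap, t', s'] using! hσ ⟨t, Algebra.subset_adjoin ⟨t', rfl⟩⟩

theorem finite_aeval_eq_zero {k : Type u} [Field k] {S : Type*} [CommRing S] [Algebra S k]
    [FaithfulSMul S k] {p : Polynomial S} (hp : p ≠ 0) :
    {x : Fin 1 → k | Polynomial.aeval (x 0) p = 0}.Finite := by
  have hp' : p.map (algebraMap S k) ≠ 0 :=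
    (Polynomial.map_ne_zero_iff (FaithfulSMul.algebraMap_injective S k)).2 hp
  have hroots : {t : k | Polynomial.aeval t p = 0}.Finite := by
    simpa [Polynomial.aeval_def, Polynomial.eval_map] using!
      Polynomial.finite_setOfPred_isRoot hp'
  exact hroots.preimage (Equiv.funUnique (Fin 1) k).injective.injOn

variable {k : Type u} [Field k] [FirstOrder.Ring.CompatibleRing k] {A : Set k} {β : Type*}

/-- The ring of functions `(β → k) → k` that are definable over `A`. -/
def definableFunSubring (A : Set k) (β : Type*) : Subring ((β → k) → k) where
  carrier := {f | A.DefinableFun Language.ring f}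
  zero_mem' := by
    simpa [funext_iff] using! ((0 : Language.ring.Term β).definableFun_realize (M := k)).mono
      (Set.empty_subset A)
  one_mem' := by
    simpa [funext_iff] using! ((1 : Language.ring.Term β).definableFun_realize (M := k)).mono
      (Set.empty_subset A)
  add_mem' {f g} hf hg := by
    have hfg : A.DefinableMap Language.ring fun x => ![f x, g x] := by
      simpa [Set.DefinableMap] using! ⟨hf, hg⟩
    simpa using! Set.DefinableFun.comp hfg
      ((Set.DefinableFun.fun_symbol Ring.addFunc).mono (Set.empty_subset A))
  mul_mem' {f g} hf hg := by
    have hfg : A.DefinableMap Language.ring fun x => ![f x, g x] := by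
      simpa [Set.DefinableMap] using! ⟨hf, hg⟩
    simpa using! Set.DefinableFun.comp hfg
      ((Set.DefinableFun.fun_symbol Ring.mulFunc).mono (Set.empty_subset A))
  neg_mem' {f} hf := by
    have hf' : A.DefinableMap Language.ring fun x => ![f x] := by
      simpa [Set.DefinableMap] using! hf
    simpa using! Set.DefinableFun.comp hf'
      ((Set.DefinableFun.fun_symbol Ring.negFunc).mono (Set.empty_subset A))

theorem definableFun_intCast (z : ℤ) :
    A.DefinableFun Language.ring fun _ : β → k => (z : k) :=
  intCast_mem (definableFunSubring A β) z

/-- The elements of `k` that are definable over `A`. -/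
def definableConstants (A : Set k) : Subring k :=
  (definableFunSubring A (Fin 1)).comap (Pi.constRingHom (Fin 1 → k) k)

theorem definableConstants_mono {B : Set k} (h : A ⊆ B) :
    definableConstants A ≤ definableConstants B :=
  fun _ hc => Set.DefinableFun.mono hc h

theorem subset_definableConstants : A ⊆ definableConstants A :=
  fun _ ha => Language.ring.definableFun_const (Fin 1) ha

theorem mem_definableConstants_of_adjoin {t : k}
    (c : Algebra.adjoin (definableConstants A) {t}) :
    (c : k) ∈ definableConstants (insert t A) := by
  obtain ⟨c, hc⟩ := c
  induction hc using Algebra.adjoin_induction with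
  | mem x hx => exact subset_definableConstants (.inl hx)
  | algebraMap r => exact definableConstants_mono (Set.subset_insert _ _) r.2
  | add x y _ _ hx hy => exact add_mem hx hy
  | mul x y _ _ hx hy => exact mul_mem hx hy

section Polynomial

open Polynomial

variable {S : Type*} [CommRing S] [Algebra S k]

theorem definable_aeval_eq_zero (hS : ∀ c : S, algebraMap S k c ∈ definableConstants A)
    (p : S[X]) : A.Definable Language.ring {x : Fin 1 → k | aeval (x 0) p = 0} := by
  have haeval : (fun x : Fin 1 → k => aeval (x 0) p) =
      ∑ i ∈ Finset.range (p.natDegree + 1),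
        Pi.constRingHom (Fin 1 → k) k (algebraMap S k (p.coeff i)) * (fun x => x 0) ^ i := by
    ext x
    simp [aeval_eq_sum_range, Algebra.smul_def]
  have hproj : (fun x : Fin 1 → k => x 0) ∈ definableFunSubring A (Fin 1) :=
    Set.DefinableFun.proj Language.ring
  have haeval_mem : (fun x : Fin 1 → k => aeval (x 0) p) ∈ definableFunSubring A (Fin 1) :=
    haeval ▸ sum_mem fun i _ => mul_mem (hS _) (pow_mem hproj i)
  exact Set.DefinableFun.ofPred_eq haeval_mem (zero_mem (definableFunSubring A (Fin 1)))

variable [FaithfulSMul S k]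

theorem exists_transcendental_of_infinite_of_definable (hk : Aleph0Saturated Language.ring k)
    (hA : A.Finite) {X : Set (Fin 1 → k)} (hX : A.Definable Language.ring X) (hi : X.Infinite)
    (hS : ∀ c : S, algebraMap S k c ∈ definableConstants A) :
    ∃ t, ![t] ∈ X ∧ Transcendental S t := by
  by_contra! hno
  obtain ⟨D, hD, hDf, hDu⟩ := hk.exists_finite_subcover hA
    (C := insert Xᶜ ((fun p : S[X] => {x : Fin 1 → k | aeval (x 0) p = 0}) '' {0}ᶜ))
    (Set.forall_mem_insert.2
      ⟨hX.compl, Set.forall_mem_image.2 fun p _ => definable_aeval_eq_zero hS p⟩) <| by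
      refine Set.eq_univ_of_forall fun x => ?_
      by_cases hx : x ∈ X
      · obtain ⟨p, hp, hpx⟩ := not_not.1 (hno (x 0) ((FinVec.etaExpand_eq x : ![x 0] = x) ▸ hx))
        exact ⟨_, .inr ⟨p, hp, rfl⟩, hpx⟩
      · exact ⟨Xᶜ, .inl rfl, hx⟩
  refine hi (Set.Finite.subset (s := ⋃₀ (D \ {Xᶜ})) (hDf.sdiff.sUnion fun s hs => ?_) ?_)
  · obtain ⟨p, hp, rfl⟩ := (hD hs.1).resolve_left hs.2
    exact finite_aeval_eq_zero hp
  · intro x hx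
    obtain ⟨s, hs, hxs⟩ : x ∈ ⋃₀ D := hDu ▸ Set.mem_univ x
    exact ⟨s, ⟨hs, fun hsX => (hsX ▸ hxs : x ∈ Xᶜ) hx⟩, hxs⟩

end Polynomial

theorem finite_or_finite_compl_of_aleph0Saturated [IsAlgClosed k]
    (hk : Aleph0Saturated Language.ring k) {X : Set (Fin 1 → k)}
    (hX : A.Definable Language.ring X) : X.Finite ∨ Xᶜ.Finite := by
  obtain ⟨A, -, hX⟩ := Set.definable_iff_finitely_definable.1 hX
  by_contra! hno
  let R := definableConstants (A : Set k)
  obtain ⟨t, htX, ht⟩ := exists_transcendental_of_infinite_of_definable hk A.finite_toSet hX hno.1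
    (S := R) Subtype.property
  obtain ⟨s, hsX, hs⟩ := exists_transcendental_of_infinite_of_definable hk
    (A.finite_toSet.insert t) (hX.compl.mono (Set.subset_insert _ _)) hno.2
    (S := Algebra.adjoin R {t}) mem_definableConstants_of_adjoin
  have hts : s ∉ ({t} : Set k) := by
    rintro rfl
    exact hs (isAlgebraic_algebraMap
      (⟨s, Algebra.self_mem_adjoin_singleton _ s⟩ : Algebra.adjoin R {s}))
  have hind : AlgebraicIndepOn R id {t, s} := by
    rw [Set.pair_comm, AlgebraicIndepOn.insert_iff hts]
    exact ⟨by simpa using ht, by rwa [Set.image_id]⟩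
  obtain ⟨σ, hσ⟩ := exists_algEquiv_map_eq_of_algebraicIndepOn hind
  have hσA (a : k) (ha : a ∈ (A : Set k)) : σ a = a :=
    σ.commutes (⟨a, subset_definableConstants ha⟩ : R)
  have hσt : σ ∘ ![t] = ![s] := by ext; simpa using hσ
  have hσX := (definable_comp_mem_iff hX
    (FirstOrder.Ring.languageEquivEquivRingEquiv.symm σ.toRingEquiv) hσA ![t]).2 htX
  exact hsX (hσt ▸ hσX)

end StronglyMinimal

section Ultraproduct

open Filter

theorem exists_forall_eventually_of_le_atTop {l : Filter ℕ} (hl : l ≤ atTop) {B : ℕ → Type*}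
    [∀ m, Nonempty (B m)] {Q : ℕ → ∀ m, B m → Prop}
    (h : ∀ i, ∀ᶠ m in l, ∃ b, ∀ j ≤ i, Q j m b) :
    ∃ b : ∀ m, B m, ∀ j, ∀ᶠ m in l, Q j m (b m) := by
  classical
  -- A diagonal choice: `b m` meets as long an initial segment of `Q 0, …, Q m` as possible.
  let N (m : ℕ) : ℕ := Nat.findGreatest (fun i => ∃ b, ∀ j ≤ i, Q j m b) m
  have hb (m : ℕ) : ∃ b : B m, (∃ b, ∀ j ≤ N m, Q j m b) → ∀ j ≤ N m, Q j m b := by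
    by_cases hN : ∃ b, ∀ j ≤ N m, Q j m b
    · exact hN.imp fun b hb _ => hb
    · exact ⟨Classical.arbitrary _, fun hN' => absurd hN' hN⟩
  choose b hb using hb
  refine ⟨b, fun j => ?_⟩
  filter_upwards [h j, hl (eventually_ge_atTop j)] with m hm hjm
  exact hb m (Nat.findGreatest_spec (P := fun i => ∃ b, ∀ j ≤ i, Q j m b) hjm hm) j
    (Nat.le_findGreatest hjm hm)

variable {L : FirstOrder.Language.{v, w}}

/-- The element of an ultraproduct represented by a family of elements of the factors. -/
abbrev ultraproductMk {ι : Type*} (u : Ultrafilter ι) {M : ι → Type*} (x : ∀ m, M m) :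
    (u : Filter ι).Product M :=
  x

theorem realize_constantsVarsEquiv_iff {N : Type*} [L.Structure N] {A : Set N} {α : Type*}
    (θ : L[[A]].Formula α) (x : α → N) :
    Formula.Realize (BoundedFormula.constantsVarsEquiv θ) (Sum.elim (fun a : A => (a : N)) x) ↔
      θ.Realize x :=
  BoundedFormula.realize_constantsVarsEquiv

theorem realize_ultraproduct_withConstants_iff {ι : Type*} {u : Ultrafilter ι} {M : ι → Type*}
    [∀ m, L.Structure (M m)] [∀ m, Nonempty (M m)] {A : Set ((u : Filter ι).Product M)}
    {r : A → ∀ m, M m} (hr : ∀ a, ultraproductMk u (r a) = a) {α : Type*}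
    (θ : L[[A]].Formula α) (b : α → ∀ m, M m) :
    θ.Realize (fun i => ultraproductMk u (b i)) ↔ ∀ᶠ m in u,
      Formula.Realize (BoundedFormula.constantsVarsEquiv θ)
        (Sum.elim (fun a => r a m) fun i => b i m) := by
  have helim (m : ι) : (Sum.elim (fun a => r a m) fun i => b i m) =
      fun i => Sum.elim r b i m := by
    ext (a | i) <;> rfl
  have hcast : (fun i => ultraproductMk u (Sum.elim r b i)) =
      Sum.elim (fun a : A => (a : (u : Filter ι).Product M)) fun i => ultraproductMk u (b i) := by
    ext (a | i)
    · exact hr a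
    · rfl
  simp only [helim]
  rw [← Ultraproduct.realize_formula_cast, hcast]
  exact (realize_constantsVarsEquiv_iff θ _).symm

theorem aleph0Saturated_ultraproduct [Countable L.Symbols] {u : Ultrafilter ℕ}
    (hu : (u : Filter ℕ) ≤ atTop) (M : ℕ → Type*) [∀ m, L.Structure (M m)]
    [∀ m, Nonempty (M m)] : Aleph0Saturated L ((u : Filter ℕ).Product M) := by
  intro A hA n p hp
  have := hA.to_subtype
  obtain ⟨θ, hθ⟩ := exists_surjective_nat (L[[A]].Formula (Fin n))
  have hrep (x : (u : Filter ℕ).Product M) : ∃ f, ultraproductMk u f = x :=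
    Quotient.exists_rep x
  choose r hr using hrep
  let Q (j m : ℕ) (b : Fin n → M m) : Prop :=
    θ j ∈ p → Formula.Realize (BoundedFormula.constantsVarsEquiv (θ j))
      (Sum.elim (fun a : A => r a m) b)
  have hQ (i : ℕ) : ∀ᶠ m in u, ∃ b, ∀ j ≤ i, Q j m b := by
    obtain ⟨b, hb⟩ := hp (θ '' Set.Iic i ∩ p) Set.inter_subset_right
      (((Set.finite_Iic i).image θ).inter_of_left p)
    have hj (j : ℕ) (hj : j ∈ Set.Iic i) : ∀ᶠ m in u, Q j m fun l => r (b l) m := by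
      refine eventually_imp_distrib_left.2 fun hjp => ?_
      refine (realize_ultraproduct_withConstants_iff (fun a => hr a) (θ j) fun l => r (b l)).1 ?_
      simpa only [hr] using hb (θ j) ⟨⟨j, hj, rfl⟩, hjp⟩
    filter_upwards [(eventually_all_finite (Set.finite_Iic i)).2 hj] with m hm
    exact ⟨_, hm⟩
  obtain ⟨b, hb⟩ := exists_forall_eventually_of_le_atTop hu hQ
  refine ⟨fun i => ultraproductMk u fun m => b m i, fun φ hφ => ?_⟩
  obtain ⟨j, rfl⟩ := hθ φ
  exact (realize_ultraproduct_withConstants_iff (fun a => hr a) (θ j) fun i m => b m i).2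
    ((hb j).mono fun m hm => hm hφ)

theorem exists_aleph0Saturated_elementaryEmbedding [Countable L.Symbols] (M : Type u)
    [L.Structure M] [Nonempty M] :
    ∃ (N : Type u) (_ : L.Structure N) (_ : M ↪ₑ[L] N), Aleph0Saturated L N := by
  let N := ((hyperfilter ℕ : Filter ℕ).Product fun _ : ℕ => M)
  refine ⟨N, inferInstance, ⟨fun a => ultraproductMk _ fun _ => a, fun n φ x => ?_⟩,
    aleph0Saturated_ultraproduct Nat.hyperfilter_le_atTop _⟩
  have h := Ultraproduct.realize_formula_cast (u := hyperfilter ℕ) (M := fun _ : ℕ => M) φ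
    fun i _ => x i
  rwa [eventually_const] at h

end Ultraproduct

section ElementaryExtension

theorem exists_definable_comp_mem_iff {L : FirstOrder.Language.{v, w}} {M N : Type*}
    [L.Structure M] [L.Structure N] (f : M ↪ₑ[L] N) {A : Set M} {β : Type*} {X : Set (β → M)}
    (hX : A.Definable L X) :
    ∃ Y, (Set.univ : Set N).Definable L Y ∧ ∀ x, f ∘ x ∈ Y ↔ x ∈ X := by
  obtain ⟨m, b, E, hE, rfl⟩ := exists_empty_definable_fiber hX
  obtain ⟨φ, rfl⟩ := Set.empty_definable_iff.1 hE
  refine ⟨{y | φ.Realize (Sum.elim (f ∘ b) y)}, Set.definable_iff_exists_formula_sum.2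
    ⟨φ.relabel (Sum.map (fun i => ⟨f (b i), trivial⟩) id), ?_⟩, fun x => ?_⟩
  · ext y
    simp only [Set.mem_ofPred_eq, Formula.realize_relabel, Sum.elim_comp_map, Function.comp_id]
    rfl
  · rw [Set.mem_ofPred_eq, ← Sum.comp_elim]
    exact f.map_formula φ _

variable (k : Type u) [Field k] [FirstOrder.Ring.CompatibleRing k] [IsAlgClosed k]

open FirstOrder.Ring FirstOrder.Field

theorem exists_isAlgClosed_aleph0Saturated_elementaryEmbedding (p : ℕ) [CharP k p] :
    ∃ (K : Type u) (_ : Field K) (_ : CompatibleRing K) (_ : k ↪ₑ[Language.ring] K),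
      IsAlgClosed K ∧ CharP K p ∧ Aleph0Saturated Language.ring K := by
  have : Countable Language.ring.Symbols :=
    Cardinal.mk_le_aleph0_iff.1 (card_ring.trans_le (Cardinal.natCast_le_aleph0 (n := 5)))
  obtain ⟨K, _, f, hK⟩ := exists_aleph0Saturated_elementaryEmbedding (L := Language.ring) k
  have : (Theory.ACF p).Model K := (f.theory_model_iff _).1 inferInstance
  let _ := fieldOfModelACF p K
  have := modelField_of_modelACF p K
  let _ := compatibleRingOfModelField K
  exact ⟨K, inferInstance, inferInstance, f, isAlgClosed_of_model_ACF p K,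
    charP_of_model_fieldOfChar p K, hK⟩

variable {k}

theorem finite_or_finite_compl_of_definable {A : Set k} {X : Set (Fin 1 → k)}
    (hX : A.Definable Language.ring X) : X.Finite ∨ Xᶜ.Finite := by
  obtain ⟨K, _, _, f, _, -, hK⟩ :=
    exists_isAlgClosed_aleph0Saturated_elementaryEmbedding k (ringChar k)
  obtain ⟨Y, hY, hYX⟩ := exists_definable_comp_mem_iff f hX
  have hf : Function.Injective fun x : Fin 1 → k => f ∘ x := f.injective.comp_left
  have hpreimage : (fun x => f ∘ x) ⁻¹' Y = X := Set.ext hYX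
  rw [← hpreimage, ← Set.preimage_compl]
  exact (finite_or_finite_compl_of_aleph0Saturated hK hY).imp
    (fun h => h.preimage hf.injOn) fun h => h.preimage hf.injOn

end ElementaryExtension

section AxGrothendieck

/-- A relation `r` is surjunctive if, whenever it is the graph of an injective partial self-map
whose domain contains its range, its range contains its domain. -/
def IsSurjunctive {X : Type*} (r : X → X → Prop) : Prop :=
  Relator.BiUnique r → (∀ x, (∃ w, r w x) → ∃ y, r x y) → ∀ x, (∃ y, r x y) → ∃ w, r w x

variable {L : FirstOrder.Language.{v, w}} {α β : Type*}

/-- The relation on `β → M` which `φ` defines in the structure `M` with the parameters `b`. -/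
def definedRel {M : Type*} [L.Structure M] (φ : L.Formula (α ⊕ (β ⊕ β))) (b : α → M)
    (x y : β → M) : Prop :=
  φ.Realize (Sum.elim b (Sum.elim x y))

variable [Finite β]

/-- The formula saying of the parameters `b` that `definedRel φ b` is a bi-unique relation. -/
noncomputable def biUniqueFormula (φ : L.Formula (α ⊕ (β ⊕ β))) : L.Formula α :=
  let app (i j : Fin 3) : L.Formula (α ⊕ Fin 3 × β) :=
    φ.relabel (Sum.map id (Sum.elim (Prod.mk i) (Prod.mk j)))
  let eq (i j : Fin 3) : L.Formula (α ⊕ Fin 3 × β) :=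
    Formula.iInf fun t => Term.equal (Term.var (Sum.inr (i, t))) (Term.var (Sum.inr (j, t)))
  ((app 0 2).imp ((app 1 2).imp (eq 0 1))).iAlls (Fin 3 × β) ⊓
    ((app 0 1).imp ((app 0 2).imp (eq 1 2))).iAlls (Fin 3 × β)

theorem realize_biUniqueFormula (φ : L.Formula (α ⊕ (β ⊕ β))) {M : Type*} [L.Structure M]
    (b : α → M) : (biUniqueFormula φ).Realize b ↔ Relator.BiUnique (definedRel φ b) := by
  have hforall (P : (β → M) → (β → M) → (β → M) → Prop) :
      (∀ z : Fin 3 × β → M, P (fun t => z (0, t)) (fun t => z (1, t)) fun t => z (2, t)) ↔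
        ∀ x₀ x₁ x₂, P x₀ x₁ x₂ :=
    ⟨fun h x₀ x₁ x₂ => h fun p => ![x₀, x₁, x₂] p.1 p.2, fun h z => h _ _ _⟩
  have happ (z : Fin 3 × β → M) (i j : Fin 3) :
      Sum.elim b z ∘ Sum.map id (Sum.elim (Prod.mk i) (Prod.mk j)) =
        Sum.elim b (Sum.elim (fun t => z (i, t)) fun t => z (j, t)) := by
    ext (t | t | t) <;> rfl
  simp only [biUniqueFormula, Formula.realize_inf, Formula.realize_iAlls, Formula.realize_imp,
    Formula.realize_relabel, happ, Formula.realize_iInf, Formula.realize_equal,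
    Term.realize_var, Sum.elim_inr, Relator.BiUnique, Relator.LeftUnique, Relator.RightUnique,
    funext_iff]
  exact and_congr (hforall fun x y z => definedRel φ b x z → definedRel φ b y z → ∀ t, x t = y t)
    (hforall fun x y z => definedRel φ b x y → definedRel φ b x z → ∀ t, y t = z t)

/-- The sentence saying that `definedRel φ b` is surjunctive for all parameters `b`. -/
noncomputable def surjunctiveSentence [Finite α] (φ : L.Formula (α ⊕ (β ⊕ β))) : L.Sentence :=
  let dom : L.Formula (α ⊕ β) := (φ.relabel (Equiv.sumAssoc α β β).symm).iExs β
  let cod : L.Formula (α ⊕ β) :=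
    (φ.relabel ((Equiv.sumAssoc α β β).symm ∘ Sum.map id Sum.swap)).iExs β
  Formula.iAlls α (((biUniqueFormula φ).imp
    (((cod.imp dom).iAlls β).imp ((dom.imp cod).iAlls β))).relabel Sum.inr)

theorem realize_surjunctiveSentence [Finite α] (φ : L.Formula (α ⊕ (β ⊕ β))) (M : Type*)
    [L.Structure M] :
    M ⊨ surjunctiveSentence φ ↔ ∀ b : α → M, IsSurjunctive (definedRel φ b) := by
  have hassoc (b : α → M) (x y : β → M) :
      Sum.elim (Sum.elim b x) y ∘ (Equiv.sumAssoc α β β).symm = Sum.elim b (Sum.elim x y) := by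
    ext (t | t | t) <;> rfl
  have hswap (b : α → M) (x y : β → M) :
      Sum.elim b (Sum.elim x y) ∘ Sum.map id Sum.swap = Sum.elim b (Sum.elim y x) := by
    ext (t | t | t) <;> rfl
  simp only [surjunctiveSentence, Sentence.Realize, Formula.realize_iAlls, Formula.realize_imp,
    Formula.realize_relabel, Formula.realize_iExs, realize_biUniqueFormula, ← Function.comp_assoc,
    hassoc, hswap, Sum.elim_comp_inr]
  rfl

theorem isSurjunctive_of_finite_invariant {X : Type*} {r : X → X → Prop}
    (h : ∀ x, ∃ s : Set X, s.Finite ∧ x ∈ s ∧ ∀ y ∈ s, ∀ z, r y z → z ∈ s) :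
    IsSurjunctive r := by
  intro hr hdom x hx
  obtain ⟨s, hs, hxs, hmaps⟩ := h x
  let D : Set X := {y ∈ s | ∃ z, r y z}
  have hD (y : D) : ∃ z : D, r y z :=
    let ⟨z, hz⟩ := y.2.2
    ⟨⟨z, hmaps y y.2.1 z hz, hdom z ⟨y, hz⟩⟩, hz⟩
  choose f hf using hD
  have hinj : Function.Injective f := fun y z hyz => Subtype.ext (hr.1 (hf y) (hyz ▸ hf z))
  have : Finite D := (hs.subset (Set.sep_subset _ _)).to_subtype
  obtain ⟨w, hw⟩ := Finite.surjective_of_injective hinj ⟨x, hxs, hx⟩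
  have hwx := hf w
  rw [hw] at hwx
  exact ⟨w, hwx⟩

open FirstOrder.Ring FirstOrder.Field

theorem exists_pow_eq_self_of_finite (p : ℕ) [Fact p.Prime]
    {S : Set (AlgebraicClosure (ZMod p))} (hS : S.Finite) :
    ∃ n ≠ 0, ∀ a ∈ S, a ^ p ^ n = a := by
  let F := IntermediateField.adjoin (ZMod p) S
  have := hS.to_subtype
  have : FiniteDimensional (ZMod p) F :=
    IntermediateField.finiteDimensional_adjoin fun x _ => Algebra.IsIntegral.isIntegral x
  have : Finite F := Module.finite_of_finite (ZMod p)
  have : Fintype F := Fintype.ofFinite F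
  obtain ⟨n, -, hn⟩ := FiniteField.card F p
  refine ⟨n, n.ne_zero, fun a ha => ?_⟩
  rw [← hn]
  exact congrArg Subtype.val
    (FiniteField.pow_card (⟨a, IntermediateField.subset_adjoin _ _ ha⟩ : F))

theorem isSurjunctive_definedRel_algebraicClosure_zmod (p : ℕ) [Fact p.Prime]
    [CompatibleRing (AlgebraicClosure (ZMod p))] [Finite α]
    (φ : Language.ring.Formula (α ⊕ (β ⊕ β))) (b : α → AlgebraicClosure (ZMod p)) :
    IsSurjunctive (definedRel φ b) := by
  refine fun hr => isSurjunctive_of_finite_invariant (fun x => ?_) hr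
  obtain ⟨n, hn, hbx⟩ := exists_pow_eq_self_of_finite p
    ((Set.finite_range b).union (Set.finite_range x))
  let σ := iterateFrobeniusEquiv (AlgebraicClosure (ZMod p)) p n
  have hσ (a) : σ a = a ^ p ^ n := iterateFrobeniusEquiv_def _ p n a
  have hfixed : {a | σ a = a}.Finite := by
    refine (Polynomial.finite_setOfPred_isRoot
      (FiniteField.X_pow_card_pow_sub_X_ne_zero _ hn (Fact.out : p.Prime).one_lt)).subset ?_
    intro a ha
    simpa [sub_eq_zero, hσ] using ha
  refine ⟨{y | ∀ t, σ (y t) = y t}, Set.Finite.pi' fun _ => hfixed,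
    fun t => (hσ _).trans (hbx _ (Or.inr ⟨t, rfl⟩)), fun y hy z hyz t => ?_⟩
  have hσb : σ ∘ b = b := funext fun i => (hσ _).trans (hbx _ (Or.inl ⟨i, rfl⟩))
  have hσy : σ ∘ y = y := funext hy
  have hσyz : definedRel φ (σ ∘ b) (σ ∘ y) (σ ∘ z) := by
    rw [definedRel, ← Sum.comp_elim, ← Sum.comp_elim]
    exact (StrongHomClass.realize_formula (languageEquivEquivRingEquiv.symm σ) φ).2 hyz
  rw [hσb, hσy] at hσyz
  exact congrFun (hr.2 hσyz hyz) t

theorem models_surjunctiveSentence [Finite α] {p : ℕ} (hp : p.Prime ∨ p = 0)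
    (φ : Language.ring.Formula (α ⊕ (β ⊕ β))) : Theory.ACF p ⊨ᵇ surjunctiveSentence φ := by
  have hprime (p : ℕ) (hp : p.Prime) : Theory.ACF p ⊨ᵇ surjunctiveSentence φ := by
    have : Fact p.Prime := ⟨hp⟩
    let _ := compatibleRingOfRing (AlgebraicClosure (ZMod p))
    rw [← (ACF_isComplete (Or.inl hp)).realize_sentence_iff _ (AlgebraicClosure (ZMod p)),
      realize_surjunctiveSentence]
    exact isSurjunctive_definedRel_algebraicClosure_zmod p φ
  obtain hp | rfl := hp
  · exact hprime p hp
  · rw [ACF_zero_realize_iff_infinite_ACF_prime_realize]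
    refine Set.infinite_univ.mono fun p _ => hprime p p.2

theorem isSurjunctive_of_definable {k : Type u} [Field k] [CompatibleRing k] [IsAlgClosed k]
    {A : Set k} {r : (β → k) → (β → k) → Prop}
    (hr : A.Definable Language.ring {x : β ⊕ β → k | r (x ∘ Sum.inl) (x ∘ Sum.inr)}) :
    IsSurjunctive r := by
  obtain ⟨m, b, E, hE, hrE⟩ := exists_empty_definable_fiber hr
  obtain ⟨φ, rfl⟩ := Set.empty_definable_iff.1 hE
  have hφ : definedRel φ b = r := by
    ext x y
    exact (Set.ext_iff.1 hrE (Sum.elim x y)).symm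
  have hp := CharP.char_is_prime_or_zero k (ringChar k)
  have hk := models_surjunctiveSentence hp φ
  rw [← (ACF_isComplete hp).realize_sentence_iff _ k, realize_surjunctiveSentence] at hk
  exact hφ ▸ hk b

theorem surjective_of_injective_of_definableFun {k : Type u} [Field k] [CompatibleRing k]
    [IsAlgClosed k] {A : Set k} {f : (β → k) → β → k} (hf : Function.Injective f)
    (hdef : A.Definable Language.ring {x : β ⊕ β → k | f (x ∘ Sum.inl) = x ∘ Sum.inr}) :
    Function.Surjective f := fun y =>
  isSurjunctive_of_definable (r := fun x y => f x = y) hdef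
    ⟨fun _ _ _ hx hy => hf (hx.trans hy.symm), fun _ _ _ hx hy => hx.symm.trans hy⟩
    (fun x _ => ⟨f x, rfl⟩) y ⟨f y, rfl⟩

end AxGrothendieck

section SignedCard

variable {α : Type*}

open Classical in
/-- The number assigned to a finite or cofinite subset of an infinite type: the number of elements
of `S` if `S` is finite, and `-(n + 1)` if `S` omits exactly `n` elements. -/
noncomputable def signedCard (S : Set α) : ℤ :=
  if S.Finite then S.ncard else -(Sᶜ.ncard + 1)

theorem signedCard_of_finite {S : Set α} (hS : S.Finite) : signedCard S = S.ncard :=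
  if_pos hS

theorem signedCard_of_infinite {S : Set α} (hS : S.Infinite) : signedCard S = -(Sᶜ.ncard + 1) :=
  if_neg hS

@[simp]
theorem signedCard_empty : signedCard (∅ : Set α) = 0 := by
  simp [signedCard_of_finite]

theorem signedCard_nonneg_iff {S : Set α} : 0 ≤ signedCard S ↔ S.Finite := by
  by_cases hS : S.Finite
  · simp [signedCard_of_finite, hS]
  · simp only [signedCard_of_infinite hS, hS, iff_false]
    lia

theorem finite_sdiff_and_encard_sdiff_eq_of_signedCard_eq {S T : Set α}
    (hS : S.Finite ∨ Sᶜ.Finite) (hT : T.Finite ∨ Tᶜ.Finite) (h : signedCard S = signedCard T) :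
    (S \ T).Finite ∧ (S \ T).encard = (T \ S).encard := by
  have hfin : S.Finite ↔ T.Finite := by rw [← signedCard_nonneg_iff, h, signedCard_nonneg_iff]
  by_cases hSf : S.Finite
  · have hTf := hfin.1 hSf
    rw [signedCard_of_finite hSf, signedCard_of_finite hTf, Nat.cast_inj] at h
    rw [← hSf.sdiff.cast_ncard_eq, ← hTf.sdiff.cast_ncard_eq,
      (Set.ncard_eq_ncard_iff_ncard_sdiff_eq_ncard_sdiff hSf hTf).1 h]
    exact ⟨hSf.sdiff, rfl⟩
  · have hSc := hS.resolve_left hSf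
    have hTf := hfin.not.1 hSf
    have hTc := hT.resolve_left hTf
    rw [signedCard_of_infinite hSf, signedCard_of_infinite hTf, neg_inj, add_left_inj,
      Nat.cast_inj] at h
    rw [← compl_sdiff_compl (x := S), ← compl_sdiff_compl (x := T), ← hTc.sdiff.cast_ncard_eq,
      ← hSc.sdiff.cast_ncard_eq, (Set.ncard_eq_ncard_iff_ncard_sdiff_eq_ncard_sdiff hSc hTc).1 h]
    exact ⟨hTc.sdiff, rfl⟩

variable [Infinite α]

theorem signedCard_of_finite_compl {S : Set α} (hS : Sᶜ.Finite) :
    signedCard S = -(Sᶜ.ncard + 1) :=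
  signedCard_of_infinite (compl_compl S ▸ hS.infinite_compl)

@[simp]
theorem signedCard_univ : signedCard (Set.univ : Set α) = -1 := by
  simp [signedCard_of_finite_compl]

theorem signedCard_eq_neg_one_iff {S : Set α} (hS : S.Finite ∨ Sᶜ.Finite) :
    signedCard S = -1 ↔ S = Set.univ := by
  refine ⟨fun h => ?_, fun h => h ▸ signedCard_univ⟩
  have hSc : Sᶜ.Finite := hS.resolve_left fun hf => absurd (signedCard_nonneg_iff.2 hf) (by lia)
  rw [signedCard_of_finite_compl hSc] at h
  exact Set.compl_empty_iff.1 ((Set.ncard_eq_zero hSc).1 (by lia))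

theorem signedCard_insert {S : Set α} (hS : S.Finite ∨ Sᶜ.Finite) {a : α} (ha : a ∉ S) :
    signedCard (insert a S) = signedCard S + 1 := by
  obtain hS | hS := hS
  · rw [signedCard_of_finite hS, signedCard_of_finite (hS.insert a),
      Set.ncard_insert_of_notMem ha hS, Nat.cast_succ]
  · have hcompl : (insert a S)ᶜ = Sᶜ \ {a} := by
      ext
      simp [not_or, and_comm]
    rw [signedCard_of_finite_compl hS, signedCard_of_finite_compl (hcompl ▸ hS.sdiff), hcompl,
      ← Set.ncard_sdiff_singleton_add_one (s := Sᶜ) ha hS]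
    push_cast
    ring

theorem exists_signedCard_eq (z : ℤ) :
    ∃ S : Set α, (S.Finite ∨ Sᶜ.Finite) ∧ signedCard S = z := by
  obtain hz | hz := le_or_gt 0 z
  · obtain ⟨S, -, hS, hcard⟩ := (Set.infinite_univ (α := α)).exists_subset_ncard_eq z.toNat
    exact ⟨S, Or.inl hS, by rw [signedCard_of_finite hS]; lia⟩
  · obtain ⟨S, -, hS, hcard⟩ := (Set.infinite_univ (α := α)).exists_subset_ncard_eq (-z - 1).toNat
    have hSc : Sᶜᶜ.Finite := by rwa [compl_compl]
    exact ⟨Sᶜ, Or.inr hSc, by rw [signedCard_of_finite_compl hSc, compl_compl]; lia⟩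

end SignedCard

section DefinableBijection

theorem exists_bijOn_eqOn_inter {α : Type*} {S T : Set α} (hfin : (S \ T).Finite)
    (hcard : (S \ T).encard = (T \ S).encard) :
    ∃ g : α → α, Set.BijOn g S T ∧ Set.EqOn g id (S ∩ T) := by
  classical
  obtain hα | hα := isEmpty_or_nonempty α
  · exact ⟨id, by simp [Set.eq_empty_of_isEmpty], Set.eqOn_refl _ _⟩
  obtain ⟨e, he⟩ := hfin.exists_bijOn_of_encard_eq hcard
  have heq : Set.EqOn (T.piecewise id e) id (S ∩ T) :=
    (T.piecewise_eqOn id e).mono Set.inter_subset_right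
  have hinter : Set.BijOn (T.piecewise id e) (S ∩ T) (S ∩ T) :=
    (Set.bijOn_id _).congr heq.symm
  have hsdiff : Set.BijOn (T.piecewise id e) (S \ T) (T \ S) :=
    he.congr fun x hx => (T.piecewise_eq_of_notMem id e hx.2).symm
  have hinj : Set.InjOn (T.piecewise id e) (S ∩ T ∪ S \ T) :=
    (Set.injOn_union (Set.disjoint_sdiff_inter.symm)).2 ⟨hinter.injOn, hsdiff.injOn,
      fun x hx y hy hxy => (hsdiff.mapsTo hy).2 (hxy ▸ (hinter.mapsTo hx).1)⟩
  refine ⟨T.piecewise id e, ?_, heq⟩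
  have hbij := hinter.union hsdiff hinj
  rwa [Set.inter_union_sdiff, Set.inter_comm, Set.inter_union_sdiff] at hbij

theorem exists_injective_eqOn_of_encard_compl_le {α : Type*} [Nonempty α] {S T : Set α} {g : α → α}
    (hg : Set.BijOn g S T) (hS : Sᶜ.Finite) (hcard : Sᶜ.encard ≤ Tᶜ.encard) :
    ∃ f : α → α, Function.Injective f ∧ Set.EqOn f g S := by
  classical
  obtain ⟨e, heT, he⟩ := hS.exists_injOn_of_encard_le hcard
  refine ⟨S.piecewise g e, (Set.injective_piecewise_iff S).2 ⟨hg.injOn, he, ?_⟩,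
    S.piecewise_eqOn g e⟩
  exact fun x hx y hy hxy => heT hy (hxy ▸ hg.mapsTo hx)

/-- The graph of the restriction of `g` to `X`, encoded as a set of families indexed by `β ⊕ β`. -/
def sumGraphOn {M β : Type*} (g : (β → M) → β → M) (X : Set (β → M)) : Set (β ⊕ β → M) :=
  {x | x ∘ Sum.inl ∈ X ∧ g (x ∘ Sum.inl) = x ∘ Sum.inr}

/-- `g` maps `X` bijectively onto `Y`, and the graph of its restriction to `X` is definable over
`A`. The values of `g` outside `X` are irrelevant. -/
structure IsDefinableBijOn (L : FirstOrder.Language.{v, w}) {M : Type u} [L.Structure M]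
    (A : Set M) {β : Type*} (g : (β → M) → β → M) (X Y : Set (β → M)) : Prop where
  bijOn : Set.BijOn g X Y
  definable : A.Definable L (sumGraphOn g X)

variable {L : FirstOrder.Language.{v, w}} {M : Type u} [L.Structure M] {A : Set M} {β : Type*}
  {X Y : Set (β → M)} {f g : (β → M) → β → M}

theorem sumGraphOn_congr (h : Set.EqOn f g X) : sumGraphOn f X = sumGraphOn g X := by
  ext x
  exact and_congr_right fun hx => by rw [h hx]

theorem sumGraphOn_union : sumGraphOn g (X ∪ Y) = sumGraphOn g X ∪ sumGraphOn g Y := by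
  ext x
  exact or_and_right

theorem finite_sumGraphOn (hX : X.Finite) : (sumGraphOn g X).Finite :=
  (hX.image fun x => Sum.elim x (g x)).subset fun x hx =>
    ⟨x ∘ Sum.inl, hx.1, (congrArg (Sum.elim _) hx.2).trans (Sum.elim_comp_inl_inr x)⟩

theorem IsDefinableBijOn.exists_symm [Nonempty M] (h : IsDefinableBijOn L A g X Y) :
    ∃ g', IsDefinableBijOn L A g' Y X := by
  have hinv := h.bijOn.invOn_invFunOn
  have hsymm := h.bijOn.symm hinv.symm
  refine ⟨Function.invFunOn g X, hsymm, ?_⟩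
  have hgraph : sumGraphOn (Function.invFunOn g X) Y = (· ∘ Sum.swap) ⁻¹' sumGraphOn g X := by
    ext x
    constructor
    · rintro ⟨hxY, hx⟩
      exact ⟨hx ▸ hsymm.mapsTo hxY, (congrArg g hx).symm.trans (hinv.2 hxY)⟩
    · rintro ⟨hxX, hx⟩
      exact ⟨hx ▸ h.bijOn.mapsTo hxX, (congrArg _ hx).symm.trans (hinv.1 hxX)⟩
  exact hgraph ▸ h.definable.preimage_comp Sum.swap

theorem exists_isDefinableBijOn_of_encard_sdiff_eq [Finite β]
    (hX : (Set.univ : Set M).Definable L X) (hY : (Set.univ : Set M).Definable L Y)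
    (hfin : (X \ Y).Finite) (hcard : (X \ Y).encard = (Y \ X).encard) :
    ∃ g, IsDefinableBijOn L Set.univ g X Y := by
  obtain ⟨g, hg, hgid⟩ := exists_bijOn_eqOn_inter hfin hcard
  refine ⟨g, hg, ?_⟩
  have hid : sumGraphOn id (X ∩ Y) =
      (· ∘ Sum.inl) ⁻¹' (X ∩ Y) ∩ ⋂ t, {x : β ⊕ β → M | x (Sum.inl t) = x (Sum.inr t)} := by
    ext x
    simp [sumGraphOn, funext_iff]
  have hdiag (t : β) : (Set.univ : Set M).Definable L
      {x : β ⊕ β → M | x (Sum.inl t) = x (Sum.inr t)} :=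
    (Set.DefinableFun.proj L).ofPred_eq (Set.DefinableFun.proj L)
  rw [← Set.inter_union_sdiff X Y, sumGraphOn_union, sumGraphOn_congr hgid, hid]
  exact (((hX.inter hY).preimage_comp Sum.inl).inter
    (Set.definable_iInter_of_finite hdiag)).union (definable_of_finite (finite_sumGraphOn hfin))

theorem IsDefinableBijOn.encard_compl_eq {k : Type u} [Field k] [FirstOrder.Ring.CompatibleRing k]
    [IsAlgClosed k] [Finite β] {X Y : Set (β → k)} {g : (β → k) → β → k}
    (hg : IsDefinableBijOn Language.ring Set.univ g X Y) (hX : Xᶜ.Finite) (hY : Yᶜ.Finite) :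
    Xᶜ.encard = Yᶜ.encard := by
  wlog h : Xᶜ.encard ≤ Yᶜ.encard generalizing X Y g
  · obtain ⟨g', hg'⟩ := hg.exists_symm
    exact (this hg' hY hX (le_of_not_ge h)).symm
  obtain ⟨f, hf, hfg⟩ := exists_injective_eqOn_of_encard_compl_le hg.bijOn hX h
  have hgraph : {x : β ⊕ β → k | f (x ∘ Sum.inl) = x ∘ Sum.inr} =
      sumGraphOn g X ∪ sumGraphOn f Xᶜ := by
    rw [← sumGraphOn_congr hfg, ← sumGraphOn_union, Set.union_compl_self]
    simp [sumGraphOn]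
  have hsurj := surjective_of_injective_of_definableFun hf
    (hgraph ▸ hg.definable.union (definable_of_finite (finite_sumGraphOn hX)))
  have hcompl := (hg.bijOn.congr hfg.symm).compl ⟨hf, hsurj⟩
  rw [← hcompl.image_eq, hcompl.injOn.encard_image]

end DefinableBijection

section DefinableCounting

theorem natCast_le_encard_iff {α : Type*} {s : Set α} {n : ℕ} :
    (n : ℕ∞) ≤ s.encard ↔ ∃ f : Fin n → α, Function.Injective f ∧ ∀ i, f i ∈ s := by
  constructor
  · intro h
    obtain ⟨t, hts, ht⟩ := Set.exists_subset_encard_eq h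
    have htf : t.Finite := Set.finite_of_encard_eq_coe ht
    have := htf.to_subtype
    have e : Fin n ≃ t := (Finite.equivFinOfCardEq (by simp [Set.ncard, ht])).symm
    exact ⟨fun i => e i, Subtype.val_injective.comp e.injective, fun i => hts (e i).2⟩
  · rintro ⟨f, hf, hfs⟩
    calc (n : ℕ∞) = (Set.univ : Set (Fin n)).encard := by simp [Set.encard_univ]
      _ = (f '' Set.univ).encard := (hf.encard_image _).symm
      _ ≤ s.encard := Set.encard_le_encard (by simpa [Set.subset_def] using hfs)

theorem signedCard_eq_natCast_iff {α : Type*} {S : Set α} {n : ℕ} :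
    signedCard S = n ↔ S.encard = n := by
  by_cases hS : S.Finite
  · rw [signedCard_of_finite hS, Nat.cast_inj, ← hS.cast_ncard_eq, Nat.cast_inj]
  · refine iff_of_false (fun h => hS ?_) fun h => hS (Set.finite_of_encard_eq_coe h)
    exact signedCard_nonneg_iff.1 (h ▸ n.cast_nonneg)

theorem signedCard_eq_negSucc_iff {α : Type*} [Infinite α] {S : Set α}
    (hS : S.Finite ∨ Sᶜ.Finite) {n : ℕ} : signedCard S = Int.negSucc n ↔ Sᶜ.encard = n := by
  obtain hS | hS := hS
  · refine iff_of_false (fun h => ?_) fun h =>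
      hS.infinite_compl (Set.finite_of_encard_eq_coe h)
    exact absurd (signedCard_nonneg_iff.2 hS) (by lia)
  · rw [signedCard_of_finite_compl hS, ← hS.cast_ncard_eq, Nat.cast_inj]
    lia

variable {L : FirstOrder.Language.{v, w}} {M : Type u} [L.Structure M] {A : Set M}
  {β γ : Type*} {E : Set (β ⊕ γ → M)}

theorem definable_natCast_le_encard_fiber [Finite γ] (hE : A.Definable L E) (n : ℕ) :
    A.Definable L {p : β → M | (n : ℕ∞) ≤ {y : γ → M | Sum.elim p y ∈ E}.encard} := by
  have hmem (i : Fin n) : A.Definable L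
      {q : β ⊕ Fin n × γ → M | q ∘ Sum.map id (i, ·) ∈ E} := hE.preimage_comp _
  have heq (i j : Fin n) : A.Definable L
      {q : β ⊕ Fin n × γ → M | ∀ c, q (.inr (i, c)) = q (.inr (j, c))} := by
    simp only [Set.ofPred_forall]
    exact Set.definable_iInter_of_finite fun c =>
      (Set.DefinableFun.proj L).ofPred_eq (Set.DefinableFun.proj L)
  have hne (i j : Fin n) : A.Definable L
      {q : β ⊕ Fin n × γ → M | (∀ c, q (.inr (i, c)) = q (.inr (j, c))) → i = j} := by
    by_cases hij : i = j
    · simp [hij]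
    · simpa only [hij, imp_false] using! (heq i j).compl
  convert ((Set.definable_iInter_of_finite hmem).inter (Set.definable_iInter_of_finite fun i =>
    Set.definable_iInter_of_finite (hne i))).exists_of_finite using 1
  ext p
  have hsum (u : Fin n × γ → M) (i : Fin n) :
      Sum.elim p u ∘ Sum.map id (i, ·) = Sum.elim p (Function.curry u i) := by
    ext (j | j) <;> rfl
  simp only [Set.mem_ofPred_eq, natCast_le_encard_iff, Set.mem_inter_iff, Set.mem_iInter, hsum,
    Sum.elim_inr, (Equiv.curry (Fin n) γ M).exists_congr_left]
  simp [Function.Injective, funext_iff, and_comm]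

theorem definable_encard_fiber_eq [Finite γ] (hE : A.Definable L E) (n : ℕ) :
    A.Definable L {p : β → M | {y : γ → M | Sum.elim p y ∈ E}.encard = n} := by
  convert (definable_natCast_le_encard_fiber hE n).inter
    (definable_natCast_le_encard_fiber hE (n + 1)).compl using 1
  ext p
  simp only [Set.mem_ofPred_eq, Set.mem_inter_iff, Set.mem_compl_iff, Nat.cast_add, Nat.cast_one,
    ENat.add_one_le_iff (ENat.natCast_ne_top n), not_lt, le_antisymm_iff, and_comm]

theorem definable_signedCard_fiber_eq [Infinite M] [Finite γ] [Nonempty γ] (hE : A.Definable L E)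
    (hfin : ∀ p : β → M, {y : γ → M | Sum.elim p y ∈ E}.Finite ∨
      {y : γ → M | Sum.elim p y ∈ E}ᶜ.Finite) (z : ℤ) :
    A.Definable L {p : β → M | signedCard {y : γ → M | Sum.elim p y ∈ E} = z} := by
  cases z with
  | ofNat n =>
    simpa only [Int.ofNat_eq_natCast, signedCard_eq_natCast_iff] using
      definable_encard_fiber_eq hE n
  | negSucc n =>
    simpa only [signedCard_eq_negSucc_iff (hfin _)] using!
      definable_encard_fiber_eq hE.compl n

end DefinableCounting

theorem isBiunique_iff_exists_bijOn {α β : Type*} [Nonempty β] {R : α → β → Prop}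
    {X : Set α} {Y : Set β} :
    ((∀ x y, R x y → x ∈ X ∧ y ∈ Y) ∧ (∀ x ∈ X, ∃! y, R x y) ∧ ∀ y ∈ Y, ∃! x, R x y) ↔
      ∃ g : α → β, Set.BijOn g X Y ∧ ∀ x y, R x y ↔ x ∈ X ∧ g x = y := by
  constructor
  · rintro ⟨hXY, hX, hY⟩
    choose! g hg using fun x hx => (hX x hx).exists
    refine ⟨g, ⟨fun x hx => (hXY x _ (hg x hx)).2, fun x hx x' hx' h => ?_, fun y hy => ?_⟩,
      fun x y => ⟨fun h => ?_, ?_⟩⟩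
    · exact (hY _ (hXY x _ (hg x hx)).2).unique (hg x hx) (h ▸ hg x' hx')
    · obtain ⟨x, hx, -⟩ := hY y hy
      have hxX := (hXY x y hx).1
      exact ⟨x, hxX, (hX x hxX).unique (hg x hxX) hx⟩
    · have hxX := (hXY x y h).1
      exact ⟨hxX, (hX x hxX).unique (hg x hxX) h⟩
    · rintro ⟨hx, rfl⟩
      exact hg x hx
  · rintro ⟨g, hg, hR⟩
    simp only [hR]
    refine ⟨?_, fun x hx => ⟨g x, ⟨hx, rfl⟩, fun y hy => hy.2.symm⟩, fun y hy => ?_⟩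
    · rintro x _ ⟨hx, rfl⟩
      exact ⟨hx, hg.mapsTo hx⟩
    · obtain ⟨x, hx, rfl⟩ := hg.surjOn hy
      exact ⟨x, ⟨hx, rfl⟩, fun x' hx' => hg.injOn hx'.1 hx hx'.2⟩

namespace HPStructure

section Bijections

variable {M : Type u} {N : HPStructure M} {f : N.rel 1} {X Y : N.rel 0}

@[simp]
theorem mem_apply_zero_iff (x : Fin 1 → M) : N.Mem (x 0) X ↔ x ∈ X.1 :=
  iff_of_eq (congrArg (· ∈ X.1) (FinVec.etaExpand_eq x))

theorem isBijection_iff :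
    N.IsBijection f X Y ↔ ∃ g : (Fin 1 → M) → Fin 1 → M, Set.BijOn g X Y ∧
      f.1 = (· ∘ finSumFinEquiv (m := 1) (n := 1)) ⁻¹' sumGraphOn g X := by
  have : Nonempty M := ⟨N.num X⟩
  have hR : N.IsBijection f X Y ↔
      (∀ x y : Fin 1 → M, ![x 0, y 0] ∈ f.1 →
        x ∈ X.1 ∧ y ∈ Y.1) ∧
      (∀ x ∈ X.1, ∃! y : Fin 1 → M, ![x 0, y 0] ∈ f.1) ∧
      ∀ y ∈ Y.1, ∃! x : Fin 1 → M, ![x 0, y 0] ∈ f.1 := by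
    simp only [IsBijection, (Equiv.funUnique (Fin 1) M).symm.forall_congr_left,
      (Equiv.funUnique (Fin 1) M).symm.existsUnique_congr_left]
    simp
  rw [hR, isBiunique_iff_exists_bijOn]
  have hpair (x y : Fin 1 → M) :
      ![x 0, y 0] ∘ finSumFinEquiv (m := 1) (n := 1) = Sum.elim x y := by
    ext (i | i) <;> fin_cases i <;> rfl
  refine exists_congr fun g => and_congr_right fun _ => ⟨fun h => ?_, fun h x y => ?_⟩
  · ext w
    have hw : w = ![(![w 0] : Fin 1 → M) 0, (![w 1] : Fin 1 → M) 0] := List.ofFn_inj.1 rfl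
    rw [hw, h, Set.mem_preimage, hpair]
    rfl
  · rw [h, Set.mem_preimage, hpair]
    rfl

theorem precedes_iff_insert {n m : M} :
    N.Precedes n m ↔ ∃ X Y : N.rel 0, N.num X = n ∧ N.num Y = m ∧
      ∃ y ∉ X.1, Y.1 = insert y X.1 := by
  refine exists₂_congr fun X Y => and_congr_right fun _ => and_congr_right fun _ => ?_
  rw [(Equiv.funUnique (Fin 1) M).symm.exists_congr_left]
  refine exists_congr fun y => ?_
  have hX : (∀ x, N.Mem x X ↔ N.Mem x Y ∧ x ≠ y 0) ↔ X.1 = Y.1 \ {y} := by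
    simp only [Set.ext_iff, (Equiv.funUnique (Fin 1) M).symm.forall_congr_left]
    simp [funext_iff]
  refine (and_congr (mem_apply_zero_iff y) hX).trans ⟨fun ⟨hy, h⟩ => ?_, fun ⟨hy, h⟩ => ?_⟩
  · simp [h, Set.insert_eq_of_mem hy]
  · simp [h, Set.insert_sdiff_self_of_notMem hy]

end Bijections

section Field

variable {k : Type u} [Field k] [FirstOrder.Ring.CompatibleRing k]

theorem num_ofField (X : (ofField k).rel 0) : (ofField k).num X = (signedCard X.1 : k) := by
  classical
  simp only [ofField, signedCard, apply_ite (Int.cast : ℤ → k)]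
  push_cast
  rfl

theorem mem_rel_ofField_of_finite_or_finite_compl {n : ℕ} {S : Set (Fin (n + 1) → k)}
    (hS : S.Finite ∨ Sᶜ.Finite) : S ∈ (ofField k).rel n :=
  hS.elim definable_of_finite fun h => compl_compl S ▸ (definable_of_finite h).compl

theorem exists_isBijection_ofField_iff {X Y : (ofField k).rel 0} :
    (∃ f, (ofField k).IsBijection f X Y) ↔
      ∃ g, IsDefinableBijOn Language.ring Set.univ g X.1 Y.1 := by
  simp only [isBijection_iff]
  constructor
  · rintro ⟨f, g, hg, hf⟩
    refine ⟨g, hg, ?_⟩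
    have hgraph : sumGraphOn g X.1 = (· ∘ (finSumFinEquiv (m := 1) (n := 1)).symm) ⁻¹' f.1 := by
      rw [hf, Set.preimage_preimage]
      simp [Function.comp_assoc]
    exact hgraph ▸ Set.Definable.preimage_comp _ f.2
  · rintro ⟨g, hg⟩
    exact ⟨⟨_, hg.definable.preimage_comp _⟩, g, hg.bijOn, rfl⟩

theorem isZero_ofField_iff {n : k} : (ofField k).IsZero n ↔ n = 0 := by
  have hE (E : (ofField k).rel 0) : (∀ x, ¬ (ofField k).Mem x E) ↔ E.1 = ∅ := by
    simp [(Equiv.funUnique (Fin 1) k).symm.forall_congr_left, Set.eq_empty_iff_forall_notMem]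
  simp only [IsZero, hE, num_ofField]
  refine ⟨?_, ?_⟩
  · rintro ⟨E, hE, rfl⟩
    simp [hE]
  · rintro rfl
    exact ⟨⟨∅, Set.definable_empty⟩, rfl, by simp⟩

variable [IsAlgClosed k]

theorem signedCard_eq_of_isDefinableBijOn {X Y : (ofField k).rel 0}
    {g : (Fin 1 → k) → Fin 1 → k} (hg : IsDefinableBijOn Language.ring Set.univ g X.1 Y.1) :
    signedCard X.1 = signedCard Y.1 := by
  have hfin := hg.bijOn.finite_iff_finite
  by_cases hX : X.1.Finite
  · rw [signedCard_of_finite hX, signedCard_of_finite (hfin.1 hX), hg.bijOn.ncard_eq]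
  · have hXc := (finite_or_finite_compl_of_definable X.2).resolve_left hX
    have hYc := (finite_or_finite_compl_of_definable Y.2).resolve_left (hfin.not.1 hX)
    rw [signedCard_of_infinite hX, signedCard_of_infinite (hfin.not.1 hX), Set.ncard,
      hg.encard_compl_eq hXc hYc, Set.ncard]

theorem precedes_ofField_iff {n m : k} :
    (ofField k).Precedes n m ↔ ∃ z : ℤ, z ≠ -1 ∧ n = z ∧ m = z + 1 := by
  simp only [precedes_iff_insert, num_ofField]
  constructor
  · rintro ⟨X, Y, rfl, rfl, y, hy, hXY⟩
    have hX := finite_or_finite_compl_of_definable X.2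
    refine ⟨signedCard X.1, fun h => ?_, rfl, by simp [hXY, signedCard_insert hX hy]⟩
    exact hy ((signedCard_eq_neg_one_iff hX).1 h ▸ Set.mem_univ y)
  · rintro ⟨z, hz, rfl, rfl⟩
    obtain ⟨S, hS, rfl⟩ := exists_signedCard_eq (α := Fin 1 → k) z
    obtain ⟨y, hy⟩ := (Set.ne_univ_iff_exists_notMem S).1 ((signedCard_eq_neg_one_iff hS).not.1 hz)
    have hSy : (insert y S).Finite ∨ (insert y S)ᶜ.Finite :=
      hS.imp (·.insert y) (·.subset (Set.compl_subset_compl.2 (Set.subset_insert y S)))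
    exact ⟨⟨S, mem_rel_ofField_of_finite_or_finite_compl hS⟩,
      ⟨_, mem_rel_ofField_of_finite_or_finite_compl hSy⟩, rfl,
      by simp [signedCard_insert hS hy], y, hy, rfl⟩

theorem Hereditary.intCast_mem {F : (ofField k).rel 0} (hF : (ofField k).Hereditary F) {c z : ℤ}
    (hcz : c ≤ z) (h : z ≤ -1 ∨ 0 ≤ c) (hc : (ofField k).Mem (c : k) F) :
    (ofField k).Mem (z : k) F := by
  induction z, hcz using Int.leInduction with
  | base => exact hc
  | succ z hcz ih =>
    exact hF z _ (ih (by lia)) (precedes_ofField_iff.2 ⟨z, by lia, rfl, by simp⟩)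

variable [CharZero k]

theorem humesPrinciple_ofField : (ofField k).HumesPrinciple := by
  intro X Y
  rw [num_ofField, num_ofField, Int.cast_inj, exists_isBijection_ofField_iff]
  refine ⟨fun h => ?_, fun ⟨g, hg⟩ => signedCard_eq_of_isDefinableBijOn hg⟩
  obtain ⟨hfin, hcard⟩ := finite_sdiff_and_encard_sdiff_eq_of_signedCard_eq
    (finite_or_finite_compl_of_definable X.2)
    (finite_or_finite_compl_of_definable Y.2) h
  exact exists_isDefinableBijOn_of_encard_sdiff_eq X.2 Y.2 hfin hcard

theorem not_precedes_ofField_neg_one (m : k) : ¬ (ofField k).Precedes (-1) m := by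
  rw [precedes_ofField_iff]
  rintro ⟨z, hz, h, -⟩
  exact hz (by exact_mod_cast h.symm)

theorem Hereditary.intCast_mem_of_isClosedSet {F : (ofField k).rel 0}
    (hF : (ofField k).Hereditary F) (hFc : (ofField k).IsClosedSet F) {z : ℤ} (hz : z ≠ 0) :
    (ofField k).Mem (z : k) F := by
  have hpos (z : ℤ) (hz : 1 ≤ z) : (ofField k).Mem (z : k) F :=
    hF.intCast_mem hz (by lia)
      (hFc 0 _ (isZero_ofField_iff.2 rfl) (precedes_ofField_iff.2 ⟨0, by simp⟩))
  obtain hz | hz := lt_or_gt_of_ne hz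
  · let toTuple (c : ℤ) : Fin 1 → k := ![c]
    have htoTuple : Function.Injective toTuple := fun c d h => Int.cast_injective (congrFun h 0)
    have hFi : F.1.Infinite := ((Set.Ici_infinite 1).image htoTuple.injOn).mono
      (Set.image_subset_iff.2 hpos)
    have hFfin := (finite_or_finite_compl_of_definable F.2).resolve_left hFi
    obtain ⟨c, hcz, hc⟩ := (Set.Iic_infinite z).exists_notMem_finite
      (hFfin.preimage htoTuple.injOn)
    exact hF.intCast_mem hcz (by lia) (not_not.1 hc)
  · exact hpos z hz

theorem isPseudoNumber_ofField_iff {a : k} :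
    (ofField k).IsPseudoNumber a ↔ ∃ z : ℤ, a = z := by
  constructor
  · rintro (h | h)
    · exact ⟨0, by simpa using isZero_ofField_iff.1 h⟩
    · by_contra! ha
      let F : (ofField k).rel 0 :=
        ⟨{![a]}ᶜ, mem_rel_ofField_of_finite_or_finite_compl (.inr (by simp))⟩
      have hF (n m : k) (hnm : (ofField k).Precedes n m) : (ofField k).Mem m F := by
        obtain ⟨z, -, -, rfl⟩ := precedes_ofField_iff.1 hnm
        exact fun h => ha (z + 1) (by simpa using (congrFun h 0).symm)
      exact h F (fun n m _ => hF n m) (fun n m _ => hF n m) rfl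
  · rintro ⟨z, rfl⟩
    obtain rfl | hz := eq_or_ne z 0
    · exact .inl (isZero_ofField_iff.2 Int.cast_zero)
    · exact .inr fun F hF hFc => hF.intCast_mem_of_isClosedSet hFc hz

theorem not_successorAxiom_ofField : ¬ (ofField k).SuccessorAxiom := fun h =>
  have ⟨m, hm⟩ := h (-1) (isPseudoNumber_ofField_iff.2 ⟨-1, by simp⟩)
  not_precedes_ofField_neg_one m hm

end Field

end HPStructure

/-- The variables occurring in a term: `inl i` stands for the object variable `i`, and
`inr (n, i)` for the `(n+1)`-ary relation variable `(n, i)`. -/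
def HPTerm.vars : HPTerm → Finset (ℕ ⊕ ℕ × ℕ)
  | .var i => {.inl i}
  | .num i => {.inr (0, i)}

namespace HPFormula

/-- The variables, free or bound, occurring in the atomic subformulas of a formula, encoded as in
`HPTerm.vars`. -/
def vars : HPFormula → Finset (ℕ ⊕ ℕ × ℕ)
  | eq t s => t.vars ∪ s.vars
  | relEq n i j => {.inr (n, i), .inr (n, j)}
  | mem n i t => insert (.inr (n, i)) (Finset.univ.biUnion fun j => (t j).vars)
  | neg φ => φ.vars
  | and φ ψ => φ.vars ∪ ψ.vars
  | allObj _ φ => φ.vars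
  | allRel _ _ φ => φ.vars
  | exRel _ _ φ => φ.vars

theorem IsPi11.exists_isSigma11_sat_iff_not {ψ : HPFormula} (h : ψ.IsPi11) :
    ∃ χ : HPFormula, χ.IsSigma11 ∧ ∀ {M : Type u} (N : HPStructure M) (v : ℕ → M)
      (ρ : N.RelAssignment), N.Sat χ v ρ ↔ ¬ N.Sat ψ v ρ := by
  induction h with
  | @arith ψ h => exact ⟨neg ψ, .arith h, fun _ _ _ => Iff.rfl⟩
  | all n i _ ih =>
    obtain ⟨χ, hχ, h⟩ := ih
    exact ⟨exRel n i χ, .ex n i hχ, fun N v ρ => by simp only [HPStructure.Sat, h, not_forall]⟩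

end HPFormula

namespace HPStructure

section DefinableFamilies

variable {L : FirstOrder.Language.{v, w}} {M : Type u} [L.Structure M] {A : Set M}
  {N : HPStructure M} {V : Finset (ℕ ⊕ ℕ × ℕ)} {β γ : Type*} {v : (β → M) → ℕ → M}
  {ρ : (β → M) → N.RelAssignment}

/-- The assignments `v p`, `ρ p` to the variables in `V`, encoded as in `HPTerm.vars`, depend
`A`-definably on the parameter tuple `p`. -/
structure IsDefinableFamily (L : FirstOrder.Language.{v, w}) [L.Structure M] (A : Set M)
    (V : Finset (ℕ ⊕ ℕ × ℕ)) (v : (β → M) → ℕ → M) (ρ : (β → M) → N.RelAssignment) : Prop where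
  obj : ∀ i, .inl i ∈ V → A.DefinableFun L fun p => v p i
  rel : ∀ n i, .inr (n, i) ∈ V →
    A.Definable L {q : β ⊕ Fin (n + 1) → M | q ∘ .inr ∈ (ρ (q ∘ .inl) n i).1}

namespace IsDefinableFamily

theorem comp_inl (h : IsDefinableFamily L A V v ρ) :
    IsDefinableFamily L A V (fun q : β ⊕ γ → M => v (q ∘ .inl)) fun q => ρ (q ∘ .inl) where
  obj i hi := (h.obj i hi).preimage_comp (Option.map Sum.inl)
  rel n i hi := (h.rel n i hi).preimage_comp (Sum.map Sum.inl id)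

theorem update (h : IsDefinableFamily L A V v ρ) (i : ℕ) {f : (β → M) → M}
    (hf : A.DefinableFun L f) :
    IsDefinableFamily L A V (fun p => Function.update (v p) i (f p)) ρ where
  obj j hj := by
    obtain rfl | hji := eq_or_ne j i
    · simpa using hf
    · simpa [hji] using h.obj j hj
  rel := h.rel

theorem set (h : IsDefinableFamily L A V v ρ) (n i : ℕ) {R : (β → M) → N.rel n}
    (hR : A.Definable L {q : β ⊕ Fin (n + 1) → M | q ∘ .inr ∈ (R (q ∘ .inl)).1}) :
    IsDefinableFamily L A V v fun p => (ρ p).set n i (R p) where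
  obj := h.obj
  rel m j hj := by
    obtain rfl | hmn := eq_or_ne m n
    · obtain rfl | hji := eq_or_ne j i
      · simpa [RelAssignment.set] using hR
      · simpa [RelAssignment.set, hji] using h.rel m j hj
    · simpa [RelAssignment.set, hmn] using h.rel m j hj

end IsDefinableFamily

theorem exists_finset_isDefinableFamily (hN : ∀ n, ∀ R ∈ N.rel n, (Set.univ : Set M).Definable L R)
    (V : Finset (ℕ ⊕ ℕ × ℕ)) {z : γ → ℕ} (hz : Function.Injective z) (v : ℕ → M)
    (ρ : N.RelAssignment) : ∃ A : Finset M,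
      IsDefinableFamily L A V (fun a : γ → M => Function.extend z a v) fun _ => ρ := by
  classical
  choose B _ hB using fun x : ℕ × ℕ =>
    Set.definable_iff_finitely_definable.1 (hN x.1 (ρ x.1 x.2) (ρ x.1 x.2).2)
  refine ⟨V.biUnion (Sum.elim (fun i => {v i}) B), fun i hi => ?_, fun n i hi => ?_⟩
  · by_cases hiz : ∃ j, z j = i
    · obtain ⟨j, rfl⟩ := hiz
      simpa only [hz.extend_apply] using Set.DefinableFun.proj L
    · simp only [Function.extend_apply' _ _ _ hiz]
      exact L.definableFun_const _ (Finset.mem_biUnion.2 ⟨_, hi, Finset.mem_singleton_self _⟩)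
  · refine ((hB (n, i)).mono fun b hb => ?_).preimage_comp Sum.inr
    exact Finset.mem_biUnion.2 ⟨_, hi, hb⟩

end DefinableFamilies

section Field

variable {k : Type u} [Field k] [FirstOrder.Ring.CompatibleRing k] [IsAlgClosed k] {A : Set k}
  {V : Finset (ℕ ⊕ ℕ × ℕ)} {β : Type*} [Finite β] {v : (β → k) → ℕ → k}
  {ρ : (β → k) → (ofField k).RelAssignment}

namespace IsDefinableFamily

theorem definableFun_num (h : IsDefinableFamily ring A V v ρ) (hk : Aleph0Saturated ring k)
    (hA : A.Finite) {i : ℕ} (hi : .inr (0, i) ∈ V) :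
    A.DefinableFun ring fun p => (ofField k).num (ρ p 0 i) := by
  refine hk.definableFun_of_locally_eqOn hA fun p =>
    ⟨{q | signedCard (ρ q 0 i).1 = signedCard (ρ p 0 i).1}, rfl,
      definable_signedCard_fiber_eq (h.rel 0 i hi)
        (fun q => finite_or_finite_compl_of_definable (ρ q 0 i).2) _,
      _, definableFun_intCast (signedCard (ρ p 0 i).1), fun q hq => ?_⟩
  exact (num_ofField _).trans (congrArg Int.cast hq)

theorem definableFun_termValue (h : IsDefinableFamily ring A V v ρ) (hk : Aleph0Saturated ring k)
    (hA : A.Finite) {t : HPTerm} (ht : t.vars ⊆ V) :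
    A.DefinableFun ring fun p => (ofField k).termValue (v p) (ρ p) t := by
  cases t with
  | var i => exact h.obj i (Finset.singleton_subset_iff.1 ht)
  | num i => exact h.definableFun_num hk hA (Finset.singleton_subset_iff.1 ht)

theorem definable_sat (h : IsDefinableFamily ring A V v ρ) (hk : Aleph0Saturated ring k)
    (hA : A.Finite) {φ : HPFormula} (hφ : φ.IsArithmetical) (hφV : φ.vars ⊆ V) :
    A.Definable ring {p | (ofField k).Sat φ (v p) (ρ p)} := by
  induction φ generalizing β with
  | eq t s =>
    obtain ⟨ht, hs⟩ := Finset.union_subset_iff.1 hφV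
    exact (h.definableFun_termValue hk hA ht).ofPred_eq (h.definableFun_termValue hk hA hs)
  | relEq n i j =>
    simp only [HPFormula.vars, Finset.insert_subset_iff, Finset.singleton_subset_iff] at hφV
    have hi := h.rel n i hφV.1
    have hj := h.rel n j hφV.2
    convert! ((hi.inter hj).union (hi.compl.inter hj.compl)).forall_of_finite using 1
    ext p
    simp only [Set.mem_ofPred_eq, Set.mem_union, Set.mem_inter_iff, Set.mem_compl_iff, Sat,
      Sum.elim_comp_inl, Sum.elim_comp_inr, Subtype.ext_iff, Set.ext_iff,
      iff_iff_and_or_not_and_not]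
  | mem n i t =>
    simp only [HPFormula.vars, Finset.insert_subset_iff, Finset.biUnion_subset, Finset.mem_univ,
      true_imp_iff] at hφV
    refine (h.rel n i hφV.1).preimage_map (F := fun p => Sum.elim p fun j =>
      (ofField k).termValue (v p) (ρ p) (t j)) (Sum.rec (fun j => ?_) fun j => ?_)
    · exact Set.DefinableFun.proj _
    · exact h.definableFun_termValue hk hA (hφV.2 j)
  | neg φ ih => exact (ih h hφ hφV).compl
  | and φ ψ ihφ ihψ =>
    obtain ⟨hφ', hψ'⟩ := Finset.union_subset_iff.1 hφV
    exact (ihφ h hφ.1 hφ').inter (ihψ h hφ.2 hψ')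
  | allObj i φ ih =>
    have hupd := (h.comp_inl (γ := Fin 1)).update i (Set.DefinableFun.proj _ (i := .inr 0))
    convert! (ih hupd hφ hφV).forall_of_finite using 1
    ext p
    exact (Equiv.funUnique (Fin 1) k).symm.forall_congr_left
  | allRel => exact hφ.elim
  | exRel => exact hφ.elim

theorem isLocallyDefinable_sat (h : IsDefinableFamily ring A V v ρ) (hk : Aleph0Saturated ring k)
    (hA : A.Finite) {φ : HPFormula} (hφ : φ.IsSigma11) (hφV : φ.vars ⊆ V) :
    IsLocallyDefinable A ring {p | (ofField k).Sat φ (v p) (ρ p)} := by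
  induction hφ generalizing β with
  | arith hφ => exact isLocallyDefinable_of_definable (h.definable_sat hk hA hφ hφV)
  | ex n i _ ih =>
    rintro p ⟨R, hR⟩
    obtain ⟨m, b, E, hE, hRE⟩ := exists_empty_definable_fiber R.2
    let fiber (c : Fin m → k) : (ofField k).rel n :=
      ⟨{x | Sum.elim c x ∈ E}, definable_fiber hE c⟩
    have hset := (h.comp_inl (γ := Fin m)).set n i (R := fun q => fiber (q ∘ .inr)) <| by
      convert! (hE.mono A.empty_subset).preimage_comp (Sum.map Sum.inr id) using 1
      ext q
      exact iff_of_eq (congrArg (· ∈ E) (Sum.elim_comp_inl_inr (q ∘ Sum.map Sum.inr id)))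
    obtain rfl : R = fiber b := Subtype.ext hRE
    obtain ⟨s, hs, hsA, hps⟩ := ih hset hφV (Sum.elim p b) hR
    refine ⟨_, ?_, hsA.exists_of_finite, b, hps⟩
    rintro p' ⟨b', hb'⟩
    exact ⟨fiber b', hs hb'⟩

end IsDefinableFamily

theorem delta11Comprehension_ofField (hk : Aleph0Saturated ring k) :
    (ofField k).Delta11Comprehension := by
  intro φ ψ hφ hψ n z hz v ρ hφψ
  obtain ⟨χ, hχ, hχψ⟩ := HPFormula.IsPi11.exists_isSigma11_sat_iff_not.{u} hψ
  obtain ⟨A, hA⟩ := exists_finset_isDefinableFamily (L := ring) (fun _ _ => id)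
    (φ.vars ∪ χ.vars) hz v ρ
  have hφ_def := hA.isLocallyDefinable_sat hk A.finite_toSet hφ Finset.subset_union_left
  have hχ_def := hA.isLocallyDefinable_sat hk A.finite_toSet hχ Finset.subset_union_right
  simp only [hχψ, ← hφψ] at hχ_def
  exact ⟨⟨_, (hφ_def.definable hχ_def hk A.finite_toSet).mono (Set.subset_univ _)⟩,
    fun a => Iff.rfl⟩

end Field

end HPStructure

theorem mainTheorem7_general (k : Type u) [Field k] [FirstOrder.Ring.CompatibleRing k]
    [IsAlgClosed k] [CharZero k] :
    (∀ X : (HPStructure.ofField k).rel 0,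
      ((X : Set (Fin 1 → k)).Finite ∨ (X : Set (Fin 1 → k))ᶜ.Finite) ∧
      ((X : Set (Fin 1 → k)).Finite →
        (HPStructure.ofField k).num X = ((X : Set (Fin 1 → k)).ncard : k)) ∧
      ((X : Set (Fin 1 → k))ᶜ.Finite →
        (HPStructure.ofField k).num X = -(((X : Set (Fin 1 → k))ᶜ.ncard : k) + 1))) ∧
    (HPStructure.ofField k).HumesPrinciple ∧
    (Aleph0Saturated ring k → (HPStructure.ofField k).Delta11Comprehension) ∧
    ¬ (HPStructure.ofField k).SuccessorAxiom ∧
    (∀ a : k, (HPStructure.ofField k).IsPseudoNumber a ↔ ∃ z : ℤ, a = (z : k)) ∧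
    ∃ K : (HPStructure.ofField k).rel 0, (K : Set (Fin 1 → k)) = Set.univ ∧
      (HPStructure.ofField k).num K = -1 ∧
      ¬ ∃ m : k, (HPStructure.ofField k).Precedes ((HPStructure.ofField k).num K) m := by
  refine ⟨fun X => ⟨finite_or_finite_compl_of_definable X.2, fun hX => ?_, fun hX => ?_⟩,
    HPStructure.humesPrinciple_ofField, HPStructure.delta11Comprehension_ofField,
    HPStructure.not_successorAxiom_ofField, fun _ => HPStructure.isPseudoNumber_ofField_iff,
    ⟨Set.univ, Set.definable_univ⟩, rfl, ?_⟩
  · simp [HPStructure.num_ofField, signedCard_of_finite hX]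
  · simp [HPStructure.num_ofField, signedCard_of_finite_compl hX]
  · have hnum : (HPStructure.ofField k).num ⟨Set.univ, Set.definable_univ⟩ = -1 := by
      simp [HPStructure.num_ofField, signedCard_univ]
    exact ⟨hnum, fun ⟨m, hm⟩ => HPStructure.not_precedes_ofField_neg_one m (hnum ▸ hm)⟩

theorem HPStructure.exists_modelsDelta11HP_not_successorAxiom :
    ∃ (M : Type) (N : HPStructure M), N.ModelsDelta11HP ∧ ¬ N.SuccessorAxiom := by
  let := FirstOrder.Ring.compatibleRingOfRing (AlgebraicClosure ℚ)
  obtain ⟨K, _, _, -, _, _, hK⟩ :=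
    exists_isAlgClosed_aleph0Saturated_elementaryEmbedding (AlgebraicClosure ℚ) 0
  have := CharP.charP_to_charZero K
  exact ⟨K, ofField K, ⟨humesPrinciple_ofField, delta11Comprehension_ofField hK⟩,
    not_successorAxiom_ofField⟩

theorem mainTheorem7 :
    (∀ (k : Type u) [Field k] [FirstOrder.Ring.CompatibleRing k] [IsAlgClosed k] [CharZero k],
      FirstOrder.Language.ring.IsSaturated k →
        -- every definable `X ⊆ k` is finite or cofinite, and `#` is given by the stated formula
        (∀ X : (HPStructure.ofField k).rel 0,
          ((X : Set (Fin 1 → k)).Finite ∨ (X : Set (Fin 1 → k))ᶜ.Finite) ∧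
          ((X : Set (Fin 1 → k)).Finite →
            (HPStructure.ofField k).num X = ((X : Set (Fin 1 → k)).ncard : k)) ∧
          ((X : Set (Fin 1 → k))ᶜ.Finite →
            (HPStructure.ofField k).num X = -(((X : Set (Fin 1 → k))ᶜ.ncard : k) + 1))) ∧
        -- the structure is a model of `Δ¹₁-HP₀ + ¬SA`
        (HPStructure.ofField k).ModelsDelta11HP ∧
        ¬ (HPStructure.ofField k).SuccessorAxiom ∧
        -- the pseudo-numbers are exactly the integers
        (∀ a : k, (HPStructure.ofField k).IsPseudoNumber a ↔ ∃ z : ℤ, a = (z : k)) ∧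
        -- `#k = -1` has no successor
        (∃ K : (HPStructure.ofField k).rel 0, (K : Set (Fin 1 → k)) = Set.univ ∧
          (HPStructure.ofField k).num K = -1 ∧
          ¬ ∃ m : k, (HPStructure.ofField k).Precedes ((HPStructure.ofField k).num K) m)) ∧
    -- there is a model of `Δ¹₁-HP₀ + ¬SA`
    (∃ (M : Type) (N : HPStructure M), N.ModelsDelta11HP ∧ ¬ N.SuccessorAxiom) := by
  refine ⟨fun k _ _ _ _ hk => ?_, HPStructure.exists_modelsDelta11HP_not_successorAxiom⟩
  obtain ⟨hX, hHP, hDC, hSA, hpseudo, hK⟩ := mainTheorem7_general k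
  have := IsAlgClosed.instInfinite (K := k)
  exact ⟨hX, ⟨hHP, hDC (aleph0Saturated_of_isSaturated hk)⟩, hSA, hpseudo, hK⟩
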